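/- Setting. Let $G=(V,E)$ be a finite acyclic directed multigraph with unit-capacity channels $e\in E$ (from $\mathrm{tail}(e)$ to $\mathrm{head}(e)$), a single source $s$ without incoming channels, a set $T\subseteq V\setminus\{s\}$ of sinks without outgoing channels, and $J=V\setminus(\{s\}\cup T)$ the set of internal nodes. For $t\in T$ let $C_t$ be the minimum cut capacity between $s$ and $t$. Let $\mathcal F$ be a finite field, let the information rate $w$ be an integer with $0\le w\leq \min_{t\in T}C_t$, and put $\delta_t=C_t-w$. Write $In(i)$ for the set of channels entering node $i$, except that $In(s)=\{d_1',\dots,d_w'\}$ consists of $w$ imaginary message channels. A linear network code is a choice of local encoding coefficients $k_{d,e}\in\mathcal F$ for all $e\in E$ and $d\in In(\mathrm{tail}(e))$. Its extended global encoding kernels are the column vectors $\tilde f_e$, indexed by $In(s)\cup E$, defined by $\tilde f_{d_i'}=1_{d_i'}$ and $$\tilde f_e=\sum_{d\in In(\mathrm{tail}(e))}k_{d,e}\tilde f_d+1_e\qquad(e\in E),$$ where $1_d$ is the indicator vector of $d$. For $t\in T$ let $\tilde F_t=(\tilde f_e: e\in In(t))$, $$\Phi(t)=\{(X,0)\tilde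 F_t: X\in\mathcal F^w\},\qquad \Delta(t,\rho)=\{(0,Z)\tilde F_t: Z\in\mathcal F^{E},\ Z_e=0 \text{ for } e\notin\rho\}$$ for every error pattern $\rho\subseteq E$. Let $\mathrm{rank}_t(\rho)$ be the least $|\rho'|$ over all $\rho'\subseteq E$ such that $\Delta(t,\rho)\subseteq\Delta(t,\rho')$ for every linear network code, let $$R_t(\beta)=\{\rho\subseteq E: |\rho|=\mathrm{rank}_t(\rho)=\beta\},\qquad d_{\min}^{(t)}=\min\{\mathrm{rank}_t(\rho): \dim(\Delta(t,\rho)\cap\Phi(t))>0\}$$ (with $\min\emptyset=\infty$), and call the code regular if $\dim\Phi(t)=w$ for all $t\in T$. Theorem. Let the local encoding coefficients $k_{d,e}$ be independent random variables, each uniformly distributed on $\mathcal F$. 1. For each $t\in T$ and each integer $\beta_t$ with $0\le\beta_t\le\delta_t$, $$\Pr\big(\{\dim\Phi(t)<w\}\cup\{d_{\min}^{(t)}<\beta_t+1\}\big)\ \leq\ \frac{|R_t(\beta_t)|\binom{\delta_t-\beta_t+|J|+1}{|J|}}{(|\mathcal F|-1)^{\delta_t-\beta_t+1}}.$$ 2.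 For all integers $\beta_t$ with $0\le\beta_t\le\delta_t$ $(t\in T)$, $$\Pr\big(\{\text{the code is not regular}\}\cup\{\exists\, t\in T:\ d_{\min}^{(t)}<\beta_t+1\}\big)\ \leq\ \sum_{t\in T}\frac{|R_t(\beta_t)|\binom{\delta_t-\beta_t+|J|+1}{|J|}}{(|\mathcal F|-1)^{\delta_t-\beta_t+1}}.$$ -/

import Mathlib

open MeasureTheory ProbabilityTheory

/-- A single source multicast network with node set `V` and channel set `E`: a finite acyclic
directed multigraph (parallel channels are allowed), every channel having unit capacity.
The source has no incoming channels and the sinks have no outgoing channels. -/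
structure Network (V E : Type*) where
  tail : E → V
  head : E → V
  source : V
  sinks : Finset V
  acyclic : ∀ v : V, ¬ Relation.TransGen (fun u u' : V => ∃ e : E, tail e = u ∧ head e = u') v v
  source_notMem_sinks : source ∉ sinks
  source_no_incoming : ∀ e : E, head e ≠ source
  sink_no_outgoing : ∀ e : E, tail e ∉ sinks

namespace Network

/-- The channel `d` ends where the channel `e` starts. -/
def Precedes {V E : Type*} (N : Network V E) (d e : E) : Prop := N.head d = N.tail e

theorem transGen_of_precedes {V E : Type*} (N : Network V E) {d e : E}
    (h : Relation.TransGen N.Precedes d e) :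
    Relation.TransGen (fun u u' : V => ∃ e : E, N.tail e = u ∧ N.head e = u')
      (N.tail d) (N.tail e) := by
  induction h with
  | single h => exact Relation.TransGen.single ⟨d, rfl, h⟩
  | tail _ h ih => exact ih.tail ⟨_, rfl, h⟩

theorem precedes_wellFounded {V E : Type*} [Finite E] (N : Network V E) :
    WellFounded N.Precedes := by
  have : Std.Irrefl (Relation.TransGen N.Precedes) :=
    ⟨fun e h => N.acyclic _ (N.transGen_of_precedes h)⟩
  have h := Finite.wellFounded_of_trans_of_irrefl (Relation.TransGen N.Precedes)
  exact Subrelation.wf (fun h => Relation.TransGen.single h) h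

/-- The internal nodes: all nodes other than the source and the sinks. -/
def internalNodes {V E : Type*} [Fintype V] [DecidableEq V] (N : Network V E) : Finset V :=
  (Finset.univ \ {N.source}) \ N.sinks

/-- A set of channels is a cut between nodes `i` and `j` if its removal disconnects `i` from `j`,
that is, no directed path from `i` to `j` avoids it. -/
def IsCut {V E : Type*} (N : Network V E) (i j : V) (C : Finset E) : Prop :=
  ¬ Relation.ReflTransGen (fun u u' : V => ∃ e : E, e ∉ C ∧ N.tail e = u ∧ N.head e = u') i j

/-- The minimum cut capacity between the source and the node `t`. -/
noncomputable def minCut {V E : Type*} (N : Network V E) (t : V) : ℕ :=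
  sInf {n : ℕ | ∃ C : Finset E, N.IsCut N.source t C ∧ C.card = n}

/-- The redundancy of the sink `t` at information rate `w`
(used only when `w` is at most the minimum cut capacity). -/
noncomputable def redundancy {V E : Type*} (N : Network V E) (w : ℕ) (t : V) : ℕ :=
  N.minCut t - w

/-- The head of a channel that is either one of the `w` imaginary message channels
(`Sum.inl i`, entering the source) or a real channel (`Sum.inr e`). -/
def chHead {V E : Type*} (N : Network V E) (w : ℕ) : Fin w ⊕ E → V
  | Sum.inl _ => N.source
  | Sum.inr e => N.head e

/-- The adjacent pairs of channels `(d, e)`, `d ∈ In(tail e)`, which index the local encoding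
coefficients. At the source, `In(source)` consists of the `w` imaginary message channels. -/
abbrev AdjPair {V E : Type*} (N : Network V E) (w : ℕ) : Type _ :=
  {p : (Fin w ⊕ E) × E // N.chHead w p.1 = N.tail p.2}

/-- A linear network (error correction) code of information rate `w` over `F`: a choice of all
local encoding coefficients `k_{d,e}`. -/
abbrev Code {V E : Type*} (N : Network V E) (F : Type*) (w : ℕ) : Type _ :=
  N.AdjPair w → F

/-- The extended global encoding kernel of the channel `e`, a vector indexed by the imaginary
message channels and the real channels; see `kernel_eq` for its recursion. -/
noncomputable def kernel {V E F : Type*} [DecidableEq V] [Fintype E] [DecidableEq E] [Field F]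
    (N : Network V E) {w : ℕ} (k : N.Code F w) : E → (Fin w ⊕ E → F) :=
  N.precedes_wellFounded.fix fun e ih =>
    (∑ i : Fin w, if h : N.chHead w (Sum.inl i) = N.tail e then
        k ⟨(Sum.inl i, e), h⟩ • (Pi.single (Sum.inl i) 1 : Fin w ⊕ E → F) else 0)
    + (∑ d : E, if h : N.chHead w (Sum.inr d) = N.tail e then
        k ⟨(Sum.inr d, e), h⟩ • ih d h else 0)
    + Pi.single (Sum.inr e) 1

/-- `f_e = ∑_{d ∈ In(tail e)} k_{d,e} f_d + 1_e`, where `f_d = 1_d` for the imaginary message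
channels `d`. -/
theorem kernel_eq {V E F : Type*} [DecidableEq V] [Fintype E] [DecidableEq E] [Field F]
    (N : Network V E) {w : ℕ} (k : N.Code F w) (e : E) :
    N.kernel k e =
      (∑ c : Fin w ⊕ E, if h : N.chHead w c = N.tail e then
        k ⟨(c, e), h⟩ • (Sum.elim (fun i => Pi.single (Sum.inl i) 1) (N.kernel k) c :
          Fin w ⊕ E → F) else 0)
      + Pi.single (Sum.inr e) 1 := by
  rw [Fintype.sum_sum_type]
  unfold kernel
  rw [WellFounded.fix_eq]
  rfl

/-- The decoding matrix at `t`: its columns are the extended global encoding kernels of the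
incoming channels of `t`. -/
noncomputable def decodingMatrix {V E F : Type*} [DecidableEq V] [Fintype E] [DecidableEq E]
    [Field F] (N : Network V E) {w : ℕ} (k : N.Code F w) (t : V) :
    Matrix (Fin w ⊕ E) {e : E // N.head e = t} F :=
  Matrix.of fun c e => N.kernel k e c

end Network

/-- The row vectors `(0, Z)` with `Z` an error message vector matching the error pattern `ρ`. -/
def errorVectors (F : Type*) {E : Type*} [Field F] (w : ℕ) (ρ : Finset E) :
    Submodule F (Fin w ⊕ E → F) where
  carrier := {Y | (∀ i : Fin w, Y (Sum.inl i) = 0) ∧ ∀ e : E, e ∉ ρ → Y (Sum.inr e) = 0}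
  add_mem' := fun ha hb =>
    ⟨fun i => by simp [ha.1 i, hb.1 i], fun e he => by simp [ha.2 e he, hb.2 e he]⟩
  zero_mem' := ⟨fun _ => rfl, fun _ _ => rfl⟩
  smul_mem' := fun c _ ha =>
    ⟨fun i => by simp [ha.1 i], fun e he => by simp [ha.2 e he]⟩

/-- The row vectors `(X, 0)` with `X` a source message vector. -/
def messageVectors (F E : Type*) [Field F] (w : ℕ) : Submodule F (Fin w ⊕ E → F) where
  carrier := {Y | ∀ e : E, Y (Sum.inr e) = 0}
  add_mem' := fun ha hb e => by simp [ha e, hb e]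
  zero_mem' := fun _ => rfl
  smul_mem' := fun c _ ha e => by simp [ha e]

namespace Network

/-- The error space `Δ(t, ρ)` of the error pattern `ρ`: all `(0, Z) * decodingMatrix` with `Z`
matching `ρ`. -/
noncomputable def errorSpace {V E F : Type*} [DecidableEq V] [Fintype E] [DecidableEq E]
    [Field F] (N : Network V E) {w : ℕ} (k : N.Code F w) (t : V) (ρ : Finset E) :
    Submodule F ({e : E // N.head e = t} → F) :=
  (errorVectors F w ρ).map (N.decodingMatrix k t).vecMulLinear

/-- The message space `Φ(t)`: all `(X, 0) * decodingMatrix`. -/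
noncomputable def messageSpace {V E F : Type*} [DecidableEq V] [Fintype E] [DecidableEq E]
    [Field F] (N : Network V E) {w : ℕ} (k : N.Code F w) (t : V) :
    Submodule F ({e : E // N.head e = t} → F) :=
  (messageVectors F E w).map (N.decodingMatrix k t).vecMulLinear

/-- `ρ₁` is dominated by `ρ₂` with respect to `t`: for every linear network code the error space
of `ρ₁` is contained in that of `ρ₂`. -/
def Dominated {V E : Type*} [DecidableEq V] [Fintype E] [DecidableEq E]
    (N : Network V E) (F : Type*) [Field F] (w : ℕ) (t : V) (ρ₁ ρ₂ : Finset E) : Prop :=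
  ∀ k : N.Code F w, N.errorSpace k t ρ₁ ≤ N.errorSpace k t ρ₂

/-- The rank of the error pattern `ρ` with respect to `t`: the least size of an error pattern
dominating `ρ`. -/
noncomputable def rank {V E : Type*} [DecidableEq V] [Fintype E] [DecidableEq E]
    (N : Network V E) (F : Type*) [Field F] (w : ℕ) (t : V) (ρ : Finset E) : ℕ :=
  sInf {n : ℕ | ∃ ρ' : Finset E, N.Dominated F w t ρ ρ' ∧ ρ'.card = n}

/-- `R_t(β)`: the error patterns of size and rank `β` with respect to `t`. -/
noncomputable def fullRankPatterns {V E : Type*} [DecidableEq V] [Fintype E] [DecidableEq E]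
    (N : Network V E) (F : Type*) [Field F] (w : ℕ) (t : V) (β : ℕ) : Finset (Finset E) :=
  Finset.univ.filter fun ρ => ρ.card = β ∧ N.rank F w t ρ = β

/-- A code is regular if it is decodable at every sink. -/
def IsRegular {V E F : Type*} [DecidableEq V] [Fintype E] [DecidableEq E] [Field F]
    (N : Network V E) {w : ℕ} (k : N.Code F w) : Prop :=
  ∀ t ∈ N.sinks, Module.finrank F (N.messageSpace k t) = w

/-- The minimum distance at `t`: the least rank of an error pattern whose error space meets the
message space nontrivially (`⊤` if there is none, which for a regular code happens only at
information rate `0`). -/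
noncomputable def minDist {V E F : Type*} [DecidableEq V] [Fintype E] [DecidableEq E] [Field F]
    (N : Network V E) {w : ℕ} (k : N.Code F w) (t : V) : ℕ∞ :=
  ⨅ (ρ : Finset E)
    (_ : 0 < Module.finrank F
      (N.errorSpace k t ρ ⊓ N.messageSpace k t : Submodule F ({e : E // N.head e = t} → F))),
    (N.rank F w t ρ : ℕ∞)

/-- A random linear network error correction code: the local encoding coefficients are
independent random variables, each uniformly distributed on the finite field `F`. -/
structure IsRandomCode {V E F Ω : Type*} [MeasurableSpace F] [MeasurableSpace Ω]
    (N : Network V E) {w : ℕ} (P : Measure Ω) (k : N.AdjPair w → Ω → F) : Prop where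
  measurable : ∀ p, Measurable (k p)
  indep : iIndepFun k P
  uniform : ∀ p, P.map (k p) = uniformOn Set.univ

/-- `P_ec(t, β)`: the probability that the random code is not decodable at `t` or has minimum
distance less than `β + 1` at `t`. -/
noncomputable def failureProbAt {V E F Ω : Type*} [DecidableEq V] [Fintype E] [DecidableEq E]
    [Field F] [MeasurableSpace Ω] (N : Network V E) {w : ℕ} (P : Measure Ω)
    (k : N.AdjPair w → Ω → F) (t : V) (β : ℕ) : ℝ :=
  P.real {ω | Module.finrank F (N.messageSpace (fun p => k p ω) t) < w ∨
    N.minDist (fun p => k p ω) t < (β : ℕ∞) + 1}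

/-- `P_ec(β)`: the probability that the random code is not regular or has minimum distance less
than `β t + 1` at some sink `t`. -/
noncomputable def failureProb {V E F Ω : Type*} [DecidableEq V] [Fintype E] [DecidableEq E]
    [Field F] [MeasurableSpace Ω] (N : Network V E) {w : ℕ} (P : Measure Ω)
    (k : N.AdjPair w → Ω → F) (β : V → ℕ) : ℝ :=
  P.real {ω | ¬ N.IsRegular (fun p => k p ω) ∨
    ∃ t ∈ N.sinks, N.minDist (fun p => k p ω) t < (β t : ℕ∞) + 1}

/-- The bound `|R_t(β)| * C(δ_t - β + |J| + 1, |J|) / (|F| - 1) ^ (δ_t - β + 1)`,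
used for `β ≤ δ_t`. -/
noncomputable def failureBound {V E : Type*} [Fintype V] [DecidableEq V] [Fintype E]
    [DecidableEq E] (N : Network V E) (F : Type*) [Field F] [Fintype F] (w : ℕ) (t : V)
    (β : ℕ) : ℝ :=
  ((N.fullRankPatterns F w t β).card : ℝ) *
      (Nat.choose (N.redundancy w t - β + N.internalNodes.card + 1) N.internalNodes.card : ℝ) /
    ((Fintype.card F : ℝ) - 1) ^ (N.redundancy w t - β + 1)

end Network

/-! Fix a sink `t` with minimum cut capacity `C`. Since the coefficients are independent and
uniform, probabilities are proportions of codes, and conditioning on part of the coefficients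
becomes averaging over shifts of the remaining ones.

Both kinds of failure at `t` give a nonzero message whose received vector lies in the error space of
some full rank pattern of size `β`: an undecodable code sends a nonzero message to `0`, and every
pattern of rank at most `β` is dominated by a full rank pattern of size `β`
(`exists_fullRankPattern_dominating`). So it suffices to bound the probability of this confusion for
one pattern `ρ` and to sum over `R_t(β)`.

Take a minimal set `P` of channels meeting every vertex cut between source and `t` at least `C`
times. By uncrossing tight cuts, each node other than the source and `t` has at most as many
incoming as outgoing channels in `P`. Let a predecessor-closed set `U` of nodes grow from the
source, one node at a time. The transfer from the source channels to the `P`-channels leaving `U`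
starts with rank at least `C`. A new node replaces incoming columns `x` by outgoing columns `y + x
M` with `M` uniform, which loses rank `a` with probability at most `(q - 1)^(-a)`
(`card_finrank_sup_span_drop_mul_le`).

The message coefficients at the source act as one further stage. If the internal nodes have lost
rank `l`, the source rows still have rank at least `w + (δ - β - l)` modulo the error space, so `w`
random combinations of them, with fixed offsets, are dependent modulo it with probability at most
`(q - 1)^(-(δ - β - l + 1))` (`card_exists_combination_mem_mul_le`). A failure thus needs a total
loss of `δ - β + 1` over `|J| + 1` stages with geometric tails. The ways to distribute this loss are
counted by `multichoose (|J| + 1) (δ - β + 1)`, which is the binomial coefficient of the bound. -/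

/-! ### Minimal edge sets with large cuts -/

/-- In a digraph in which every vertex cut between `s` and `t` has at least `c` edges, some edge set
retains this property while no vertex other than `s` and `t` receives more edges than it emits. -/
theorem exists_flow_of_le_cut {V E : Type*} [Fintype V] [DecidableEq V] [Fintype E] [DecidableEq E]
    (tail head : E → V) (s t : V) (c : ℕ)
    (hc : ∀ A : Finset V, s ∈ A → t ∉ A →
      c ≤ (Finset.univ.filter fun e => tail e ∈ A ∧ head e ∉ A).card) :
    ∃ P : Finset E,
      (∀ A : Finset V, s ∈ A → t ∉ A → c ≤ (P.filter fun e => tail e ∈ A ∧ head e ∉ A).card) ∧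
      ∀ v, v ≠ s → v ≠ t →
        (P.filter fun e => head e = v).card ≤ (P.filter fun e => tail e = v).card := by
  obtain ⟨P, hP⟩ := Set.Finite.exists_minimal (Set.toFinite {P : Finset E |
    ∀ A : Finset V, s ∈ A → t ∉ A → c ≤ (P.filter fun e => tail e ∈ A ∧ head e ∉ A).card})
    ⟨Finset.univ, hc⟩
  refine ⟨P, hP.prop, fun v hvs hvt => ?_⟩
  set cut : Finset V → Finset E := fun A => P.filter fun e => tail e ∈ A ∧ head e ∉ A with hcut
  have hle : ∀ A : Finset V, s ∈ A → t ∉ A → c ≤ (cut A).card := hP.prop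
  -- By minimality, deleting `e` breaks some cut condition, so `e` crosses a cut of size exactly
  -- `c`.
  have tight : ∀ e ∈ P, ∃ A : Finset V, s ∈ A ∧ t ∉ A ∧ tail e ∈ A ∧ head e ∉ A ∧
      (cut A).card = c := by
    intro e he
    by_contra! hcon
    have hmem : P.erase e ∈ {P : Finset E |
      ∀ A : Finset V, s ∈ A → t ∉ A → c ≤ (P.filter fun e => tail e ∈ A ∧ head e ∉ A).card} := by
      intro A hs ht
      rw [Finset.filter_erase]
      by_cases h : e ∈ cut A
      · have h1 := hcon A hs ht (Finset.mem_filter.1 h).2.1 (Finset.mem_filter.1 h).2.2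
        have h2 := hle A hs ht
        have h3 := Finset.card_erase_of_mem h
        change c ≤ ((cut A).erase e).card
        omega
      · change c ≤ ((cut A).erase e).card
        rw [Finset.erase_eq_of_notMem h]
        exact hle A hs ht
    exact Finset.notMem_erase e P (hP.le_of_le hmem (Finset.erase_subset e P) he)
  have submod : ∀ A B : Finset V,
      (cut (A ∪ B)).card + (cut (A ∩ B)).card ≤ (cut A).card + (cut B).card := by
    intro A B
    rw [← Finset.card_union_add_card_inter, ← Finset.card_union_add_card_inter (cut A)]
    refine add_le_add (Finset.card_le_card fun e he => ?_) (Finset.card_le_card fun e he => ?_)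
    · simp only [hcut, Finset.mem_union, Finset.mem_inter, Finset.mem_filter] at he ⊢
      tauto
    · simp only [hcut, Finset.mem_union, Finset.mem_inter, Finset.mem_filter] at he ⊢
      tauto
  rcases (P.filter fun e => head e = v).eq_empty_or_nonempty with h0 | ⟨e₀, he₀⟩
  · simp [h0]
  obtain ⟨A₀, hs₀, ht₀, _, hh₀, hc₀⟩ := tight e₀ (Finset.mem_filter.1 he₀).1
  rw [(Finset.mem_filter.1 he₀).2] at hh₀
  obtain ⟨A, hA⟩ := Set.Finite.exists_maximal (Set.toFinite {A : Finset V |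
    s ∈ A ∧ t ∉ A ∧ v ∉ A ∧ (cut A).card = c}) ⟨A₀, hs₀, ht₀, hh₀, hc₀⟩
  obtain ⟨hsA, htA, hvA, hcA⟩ := hA.prop
  -- Uncrossing: if `B` is a tight cut crossed by `e`, submodularity makes `A ∪ B` tight. It avoids
  -- `v`, so maximality of `A` forces `tail e ∈ A`.
  have htail : ∀ e ∈ P, head e = v → tail e ∈ A := by
    intro e he hev
    obtain ⟨B, hsB, htB, h1, h2, hcB⟩ := tight e he
    rw [hev] at h2
    have h3 := submod A B
    have h4 := hle (A ∪ B) (by simp [hsA]) (by simp [htA, htB])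
    have h5 := hle (A ∩ B) (by simp [hsA, hsB]) (by simp [htA])
    have h6 : A ∪ B ∈ {A : Finset V | s ∈ A ∧ t ∉ A ∧ v ∉ A ∧ (cut A).card = c} :=
      ⟨by simp [hsA], by simp [htA, htB], by simp [hvA, h2], by omega⟩
    exact hA.le_of_ge h6 Finset.subset_union_left (Finset.mem_union_right _ h1)
  have hin : (P.filter fun e => head e = v) ⊆ cut A := by
    intro e he
    obtain ⟨h1, h2⟩ := Finset.mem_filter.1 he
    exact Finset.mem_filter.2 ⟨h1, htail e h1 h2, h2 ▸ hvA⟩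
  -- Moving `v` into the tight cut `A` loses all channels into `v` and gains at most those out of
  -- `v`. As the new cut still has at least `c` channels, the loss cannot exceed the gain.
  have hsub : cut (insert v A) ⊆
      (cut A \ P.filter fun e => head e = v) ∪ P.filter fun e => tail e = v := by
    intro e he
    simp only [hcut, Finset.mem_union, Finset.mem_sdiff, Finset.mem_filter,
      Finset.mem_insert] at he ⊢
    tauto
  have h1 := hle (insert v A) (by simp [hsA]) (by simp [htA, hvt.symm])
  have h2 := Finset.card_le_card hsub
  have h3 := Finset.card_union_le (cut A \ P.filter fun e => head e = v)
    (P.filter fun e => tail e = v)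
  have h4 := Finset.card_sdiff_add_card_eq_card hin
  omega

/-! ### Conditioning and accumulated losses, as counting -/

/-- Averaging over shifts: if `Q` is invariant under the shifts `φ h`, and for each `g` satisfying
`Q` at most a fraction `1 / m` of the shifts of `g` satisfy `R`, then at most a fraction `1 / m` of
the elements satisfying `Q` satisfy `R`. -/
theorem card_filter_and_mul_le_of_shift {G H : Type*} [Fintype G] [AddCommGroup G] [Fintype H]
    [Nonempty H] (φ : H → G) (Q R : G → Prop) [DecidablePred Q] [DecidablePred R] (m : ℕ)
    (hQ : ∀ g h, Q (g + φ h) ↔ Q g)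
    (hR : ∀ g, Q g → (Finset.univ.filter fun h => R (g + φ h)).card * m ≤ Fintype.card H) :
    (Finset.univ.filter fun g => Q g ∧ R g).card * m ≤ (Finset.univ.filter Q).card := by
  have key : (Finset.univ.filter fun g => Q g ∧ R g).card * Fintype.card H =
      ∑ g ∈ Finset.univ.filter Q, (Finset.univ.filter fun h => R (g + φ h)).card := by
    -- For fixed `h`, translation by `φ h` permutes the elements satisfying `Q`; summing over `h`
    -- and exchanging the sums gives `key`.
    have h1 : ∀ h : H, (Finset.univ.filter fun g => Q g ∧ R g).card =
        (Finset.univ.filter fun g => Q g ∧ R (g + φ h)).card := by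
      intro h
      refine (Finset.card_bij (fun g _ => g + φ h) ?_ ?_ ?_).symm
      · intro g hg
        simpa [hQ] using hg
      · intro a _ b _ hab
        simpa using hab
      · intro b hb
        refine ⟨b - φ h, ?_, by simp⟩
        have := hQ (b - φ h) h
        simp only [sub_add_cancel] at this
        simpa [← this] using hb
    calc _ = ∑ h : H, (Finset.univ.filter fun g => Q g ∧ R g).card := by simp [mul_comm]
      _ = ∑ h : H, (Finset.univ.filter fun g => Q g ∧ R (g + φ h)).card :=
        Finset.sum_congr rfl fun h _ => h1 h
      _ = _ := by
        simp_rw [← Finset.filter_filter Q, Finset.card_filter]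
        exact Finset.sum_comm
  refine Nat.le_of_mul_le_mul_right ?_ (Fintype.card_pos (α := H))
  calc _ = (∑ g ∈ Finset.univ.filter Q, (Finset.univ.filter fun h => R (g + φ h)).card) * m := by
        rw [← key]; ring
    _ = ∑ g ∈ Finset.univ.filter Q, (Finset.univ.filter fun h => R (g + φ h)).card * m :=
        Finset.sum_mul ..
    _ ≤ ∑ g ∈ Finset.univ.filter Q, Fintype.card H :=
        Finset.sum_le_sum fun g hg => hR g (Finset.mem_filter.1 hg).2
    _ = _ := by simp

theorem sum_range_multichoose (n a : ℕ) :
    ∑ j ∈ Finset.range (a + 1), Nat.multichoose n j = Nat.multichoose (n + 1) a := by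
  induction a with
  | zero => simp
  | succ a ih => rw [Finset.sum_range_succ, ih, Nat.multichoose_succ_succ, add_comm]

/-- One more stage of loss: if the loss `l` satisfies the tail bounds of a sum of `n` geometric
losses, and `B` needs a further loss of `a - l`, then `B` satisfies the tail bound of a sum of
`n + 1` geometric losses. -/
theorem card_filter_mul_pow_le_multichoose {X : Type*} [Fintype X] (l : X → ℕ) (B : X → Prop)
    [DecidablePred B] (n Q N a : ℕ)
    (h₁ : ∀ j, (Finset.univ.filter fun x => j ≤ l x).card * Q ^ j ≤ Nat.multichoose n j * N)
    (h₂ : ∀ j < a, (Finset.univ.filter fun x => l x = j ∧ B x).card * Q ^ (a - j) ≤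
      (Finset.univ.filter fun x => l x = j).card) :
    (Finset.univ.filter B).card * Q ^ a ≤ Nat.multichoose (n + 1) a * N := by
  classical
  -- Either the earlier stages already lost `a`, or they lost exactly some `j < a` and the last
  -- stage supplies `a - j`. The factors `Q ^ (a - j)` and `Q ^ j` recombine, and the coefficients
  -- `multichoose n j` add up over `j ≤ a`.
  have hsub : Finset.univ.filter B ⊆
      ((Finset.range a).biUnion fun j => Finset.univ.filter fun x => l x = j ∧ B x) ∪
        Finset.univ.filter fun x => a ≤ l x := by
    intro x hx
    simp only [Finset.mem_union, Finset.mem_biUnion, Finset.mem_filter, Finset.mem_range,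
      Finset.mem_univ, true_and] at hx ⊢
    by_cases h : a ≤ l x
    · exact Or.inr h
    · exact Or.inl ⟨l x, by omega, rfl, hx⟩
  have hcard : (Finset.univ.filter B).card ≤
      ∑ j ∈ Finset.range a, (Finset.univ.filter fun x => l x = j ∧ B x).card +
        (Finset.univ.filter fun x => a ≤ l x).card :=
    (Finset.card_le_card hsub).trans
      ((Finset.card_union_le _ _).trans (Nat.add_le_add_right Finset.card_biUnion_le _))
  calc (Finset.univ.filter B).card * Q ^ a
      ≤ (∑ j ∈ Finset.range a, (Finset.univ.filter fun x => l x = j ∧ B x).card +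
        (Finset.univ.filter fun x => a ≤ l x).card) * Q ^ a := Nat.mul_le_mul_right _ hcard
    _ = ∑ j ∈ Finset.range a, (Finset.univ.filter fun x => l x = j ∧ B x).card * Q ^ a +
        (Finset.univ.filter fun x => a ≤ l x).card * Q ^ a := by
        rw [add_mul, Finset.sum_mul]
    _ ≤ ∑ j ∈ Finset.range a, Nat.multichoose n j * N + Nat.multichoose n a * N := by
        refine add_le_add (Finset.sum_le_sum fun j hj => ?_) (h₁ a)
        have hj := Finset.mem_range.1 hj
        calc _ = (Finset.univ.filter fun x => l x = j ∧ B x).card * Q ^ (a - j) * Q ^ j := by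
              rw [mul_assoc, ← pow_add, Nat.sub_add_cancel hj.le]
          _ ≤ (Finset.univ.filter fun x => l x = j).card * Q ^ j :=
              Nat.mul_le_mul_right _ (h₂ j hj)
          _ ≤ (Finset.univ.filter fun x => j ≤ l x).card * Q ^ j :=
              Nat.mul_le_mul_right _ (Finset.card_le_card fun x hx => by
                simp only [Finset.mem_filter, Finset.mem_univ, true_and] at hx ⊢; omega)
          _ ≤ _ := h₁ j
    _ = _ := by rw [← sum_range_multichoose, Finset.sum_range_succ, add_mul, Finset.sum_mul]

/-! ### Random matrices over a finite field -/

/-- All fibres of a surjective additive map have the same number of elements. -/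
theorem card_fiber_mul_card_of_surjective {A B : Type*} [AddGroup A] [AddGroup B] [Fintype A]
    [Fintype B] [DecidableEq B] (f : A →+ B) (hf : Function.Surjective f) (b : B) :
    (Finset.univ.filter fun a => f a = b).card * Fintype.card B = Fintype.card A := by
  have h := Finset.card_eq_sum_card_fiberwise (s := (Finset.univ : Finset A))
    (t := (Finset.univ : Finset B)) (f := f) (fun _ _ => Finset.mem_coe.2 (Finset.mem_univ _))
  have h2 : ∀ c : B, (Finset.univ.filter fun a => f a = c).card =
      (Finset.univ.filter fun a => f a = b).card := fun c =>
    AddMonoidHom.card_fiber_eq_of_mem_range f (hf c) (hf b)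
  simp only [h2, Finset.sum_const, Finset.card_univ, smul_eq_mul] at h
  rw [h, mul_comm]

/-- The number of independent `a`-tuples in `S` is a product of factors `q ^ d - q ^ i`, each at
least `q ^ i * (q - 1)`. This crude bound counts the witnesses of a rank drop. -/
theorem pow_le_card_linearIndependent {F V : Type*} [Field F] [Fintype F] [AddCommGroup V]
    [Module F V] [Finite V] (S : Submodule F V) {a : ℕ} (ha : a ≤ Module.finrank F S) :
    (Fintype.card F - 1) ^ a ≤
      Nat.card {Φ : Fin a → V // LinearIndependent F Φ ∧ ∀ i, Φ i ∈ S} := by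
  have hq : 1 < Fintype.card F := Fintype.one_lt_card
  have h := card_linearIndependent (K := F) (V := S) (k := a) ha
  have h1 : (Fintype.card F - 1) ^ a ≤ Nat.card {s : Fin a → S // LinearIndependent F s} := by
    rw [h]
    calc (Fintype.card F - 1) ^ a = ∏ _i : Fin a, (Fintype.card F - 1) := by simp
      _ ≤ _ := Finset.prod_le_prod' fun i _ => by
        have hi : (i : ℕ) + 1 ≤ Module.finrank F S := by omega
        have h2 : Fintype.card F ^ (i : ℕ) * (Fintype.card F - 1) ≤
            Fintype.card F ^ Module.finrank F S - Fintype.card F ^ (i : ℕ) := by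
          rw [Nat.mul_sub, mul_one, ← pow_succ]
          exact Nat.sub_le_sub_right (Nat.pow_le_pow_right hq.le hi) _
        exact (Nat.le_mul_of_pos_left _ (by positivity)).trans h2
  refine h1.trans (Nat.card_le_card_of_injective
    (fun s => ⟨fun i => (s.1 i : V), ?_, fun i => (s.1 i).2⟩) ?_)
  · exact s.2.map' S.subtype S.ker_subtype
  · intro s s' h
    ext i
    exact congrFun (congrArg Subtype.val h) i

/-- Linearly independent linear equations, imposed on each column of a matrix, cut the number of
matrices down by the expected factor. -/
theorem card_matrix_solutions_mul {F ι κ : Type*} [Field F] [Fintype F] [DecidableEq F] [Fintype ι]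
    [Fintype κ] [DecidableEq ι] [DecidableEq κ] {a : ℕ} (c : Fin a → ι → F)
    (hc : LinearIndependent F c) (b : κ → Fin a → F) :
    (Finset.univ.filter fun M : ι → κ → F => ∀ e l, ∑ d, c l d * M d e = b e l).card *
      Fintype.card F ^ (a * Fintype.card κ) = Fintype.card F ^ (Fintype.card ι * Fintype.card κ) := by
  have hsurj : Function.Surjective (Matrix.of c).mulVecLin := by
    rw [← LinearMap.range_eq_top]
    apply Submodule.eq_top_of_finrank_eq
    have h := LinearIndependent.rank_matrix (M := Matrix.of c) hc
    rw [Matrix.rank] at h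
    rw [h]; simp
  let f : (ι → κ → F) →+ (κ → Fin a → F) :=
    { toFun := fun M e l => ∑ d, c l d * M d e
      map_zero' := by ext; simp
      map_add' := fun M M' => by ext; simp [mul_add, Finset.sum_add_distrib] }
  have hf : Function.Surjective f := by
    intro b
    choose m hm using fun e => hsurj (b e)
    refine ⟨fun d e => m e d, ?_⟩
    ext e l
    have := congrFun (hm e) l
    simpa [f, Matrix.mulVec, dotProduct] using this
  have h := card_fiber_mul_card_of_surjective f hf b
  have h2 : (Finset.univ.filter fun M : ι → κ → F => ∀ e l, ∑ d, c l d * M d e = b e l) =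
      Finset.univ.filter fun M => f M = b := by
    ext M
    simp [f, funext_iff]
  rw [h2]
  simpa [pow_mul, mul_comm, pow_right_comm] using h

/-- The columns of a uniformly random affine combination `y + x M`, with at least as many columns
as `x` has, lose rank `a` with probability at most `1 / (q - 1) ^ a`. -/
theorem card_finrank_span_drop_mul_le {F V ι κ : Type*} [Field F] [Fintype F] [AddCommGroup V]
    [Module F V] [Finite V] [Fintype ι] [Fintype κ] [DecidableEq ι] [DecidableEq κ]
    (hικ : Fintype.card ι ≤ Fintype.card κ) (x : ι → V) (y : κ → V) (a : ℕ) :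
    Nat.card {M : ι → κ → F //
      Module.finrank F (Submodule.span F (Set.range fun e => y e + ∑ d, M d e • x d)) + a ≤
        Module.finrank F (Submodule.span F (Set.range x))} * (Fintype.card F - 1) ^ a ≤
      Fintype.card F ^ (Fintype.card ι * Fintype.card κ) := by
  classical
  set X := Submodule.span F (Set.range x) with hX
  -- The vectors `y e` need not lie in `X`. Projecting onto `X` can only lower the rank of the new
  -- columns and fixes the vectors `x d`.
  obtain ⟨π, hπ⟩ := LinearMap.exists_leftInverse_of_injective X.subtype X.ker_subtype
  have hπ' : ∀ v : X, π v = v := fun v => LinearMap.congr_fun hπ v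
  let xX : ι → X := fun d => ⟨x d, Submodule.subset_span ⟨d, rfl⟩⟩
  have hπx : ∀ d, π (x d) = xX d := fun d => hπ' (xX d)
  -- A functional on `X` is determined by its values on the `x d`. This turns independent
  -- functionals into independent equations for each column of `M`, and bounds the number of
  -- `a`-tuples by `q ^ (a * |ι|)`.
  let L : Module.Dual F X →ₗ[F] (ι → F) :=
    { toFun := fun φ d => φ (xX d)
      map_add' := fun _ _ => rfl
      map_smul' := fun _ _ => rfl }
  have hL : LinearMap.ker L = ⊥ := by
    rw [LinearMap.ker_eq_bot']
    intro φ hφ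
    have hspan : Submodule.span F (Set.range xX) = ⊤ := by
      have := Submodule.span_span_coe_preimage (R := F) (s := Set.range x)
      rw [← this]
      congr 1
      ext v
      constructor
      · rintro ⟨d, rfl⟩; exact ⟨d, rfl⟩
      · rintro ⟨d, hd⟩; exact ⟨d, Subtype.ext hd⟩
    refine LinearMap.ext_on_range hspan fun d => ?_
    exact congrFun hφ d
  have : Finite (Module.Dual F X) := Finite.of_injective L (LinearMap.ker_eq_bot.1 hL)
  set W : (ι → κ → F) → Submodule F V := fun M =>
    Submodule.span F (Set.range fun e => y e + ∑ d, M d e • x d) with hW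
  set Z : (ι → κ → F) → Submodule F (Module.Dual F X) := fun M =>
    ((W M).map π).dualAnnihilator with hZ
  set bad : Finset (ι → κ → F) := Finset.univ.filter fun M =>
    Module.finrank F (W M) + a ≤ Module.finrank F X with hbad
  have hZfin : ∀ M ∈ bad, a ≤ Module.finrank F (Z M) := by
    intro M hM
    have h1 := (Finset.mem_filter.1 hM).2
    have h2 := Subspace.finrank_add_finrank_dualAnnihilator_eq ((W M).map π)
    have h3 := Submodule.finrank_map_le π (W M)
    change _ ≤ Module.finrank F ((W M).map π).dualAnnihilator
    omega
  have : Fintype (Fin a → Module.Dual F X) := Fintype.ofFinite _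
  have hmem : ∀ M (φ : Module.Dual F X), φ ∈ Z M ↔
      ∀ e, ∑ d, φ (xX d) * M d e = - φ (π (y e)) := by
    intro M φ
    rw [hZ, Submodule.mem_dualAnnihilator]
    simp only [hW, Submodule.map_span]
    constructor
    · intro h e
      have := h _ (Submodule.subset_span ⟨_, ⟨e, rfl⟩, rfl⟩)
      simp only [map_add, map_sum, map_smul, hπx, smul_eq_mul] at this
      rw [eq_neg_iff_add_eq_zero, add_comm, ← this]
      simp [mul_comm]
    · intro h v hv
      induction hv using Submodule.span_induction with
      | mem v hv =>
        obtain ⟨_, ⟨e, rfl⟩, rfl⟩ := hv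
        have := h e
        simp only [map_add, map_sum, map_smul, hπx, smul_eq_mul]
        rw [eq_neg_iff_add_eq_zero, add_comm] at this
        rw [← this]
        simp [mul_comm]
      | zero => simp
      | add u v _ _ hu hv => simp [hu, hv]
      | smul r v _ hv => simp [hv]
  have hcount : ∀ Φ : Fin a → Module.Dual F X, LinearIndependent F Φ →
      (Finset.univ.filter fun M => ∀ l, Φ l ∈ Z M).card * Fintype.card F ^ (a * Fintype.card κ) =
        Fintype.card F ^ (Fintype.card ι * Fintype.card κ) := by
    intro Φ hΦ
    rw [← card_matrix_solutions_mul (fun l => L (Φ l)) (hΦ.map' L hL)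
      (fun e l => - Φ l (π (y e)))]
    congr 3
    ext M
    simp only [hmem]
    exact forall_comm
  set ind : Finset (Fin a → Module.Dual F X) := Finset.univ.filter fun Φ => LinearIndependent F Φ
  have hind : ind.card ≤ Fintype.card F ^ (a * Fintype.card ι) := by
    calc ind.card ≤ Fintype.card (Fin a → Module.Dual F X) := Finset.card_le_univ _
      _ ≤ Fintype.card (Fin a → ι → F) :=
        Fintype.card_le_of_injective (fun Φ l => L (Φ l)) fun Φ Φ' h => by
          ext1 l
          exact LinearMap.ker_eq_bot.1 hL (congrFun h l)
      _ = _ := by simp [pow_mul, pow_right_comm]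
  -- Pairs of a matrix and an independent `a`-tuple of functionals killing its projected columns.
  -- Each bad matrix occurs at least `(q - 1) ^ a` times, each tuple for a fraction `q ^ (-a * |κ|)`
  -- of the matrices; the hypothesis `|ι| ≤ |κ|` absorbs the number of tuples.
  have hdouble : bad.card * (Fintype.card F - 1) ^ a ≤
      ∑ Φ ∈ ind, (Finset.univ.filter fun M => ∀ l, Φ l ∈ Z M).card := by
    calc bad.card * (Fintype.card F - 1) ^ a
        ≤ ∑ M ∈ bad, (ind.filter fun Φ => ∀ l, Φ l ∈ Z M).card := by
          rw [← smul_eq_mul, ← Finset.sum_const]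
          refine Finset.sum_le_sum fun M hM => ?_
          refine (pow_le_card_linearIndependent (Z M) (hZfin M hM)).trans (le_of_eq ?_)
          rw [Nat.card_eq_fintype_card, Fintype.card_subtype, Finset.filter_filter]
      _ ≤ ∑ M, (ind.filter fun Φ => ∀ l, Φ l ∈ Z M).card :=
          Finset.sum_le_sum_of_subset (Finset.subset_univ _)
      _ = _ := by
          simp_rw [Finset.card_filter]
          exact Finset.sum_comm
  have hq : 0 < Fintype.card F := Fintype.card_pos
  have hbadcard : Nat.card {M : ι → κ → F // Module.finrank F (W M) + a ≤ Module.finrank F X} =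
      bad.card := by
    rw [Nat.card_eq_fintype_card, Fintype.card_subtype]
  rw [hbadcard]
  refine hdouble.trans (Nat.le_of_mul_le_mul_right ?_ (pow_pos hq (a * Fintype.card κ)))
  rw [Finset.sum_mul]
  calc _ = ∑ Φ ∈ ind, Fintype.card F ^ (Fintype.card ι * Fintype.card κ) :=
        Finset.sum_congr rfl fun Φ hΦ => hcount Φ (Finset.mem_filter.1 hΦ).2
    _ = ind.card * Fintype.card F ^ (Fintype.card ι * Fintype.card κ) := by simp
    _ ≤ Fintype.card F ^ (a * Fintype.card κ) *
          Fintype.card F ^ (Fintype.card ι * Fintype.card κ) :=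
        Nat.mul_le_mul_right _ (hind.trans (Nat.pow_le_pow_right hq (Nat.mul_le_mul_left _ hικ)))
    _ = _ := mul_comm _ _

theorem Submodule.finrank_sup_eq_finrank_add_finrank_map_mkQ {F V : Type*} [Field F]
    [AddCommGroup V] [Module F V] [FiniteDimensional F V] (W A : Submodule F V) :
    Module.finrank F (W ⊔ A : Submodule F V) =
      Module.finrank F W + Module.finrank F (A.map W.mkQ) := by
  have h := LinearMap.finrank_range_add_finrank_ker (W.mkQ.domRestrict (W ⊔ A))
  rw [LinearMap.range_domRestrict, LinearMap.ker_domRestrict, Submodule.ker_mkQ,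
    Submodule.map_sup, Submodule.mkQ_map_self, bot_sup_eq] at h
  rw [← h, add_comm]
  congr 1
  exact (Submodule.comapSubtypeEquivOfLe le_sup_left).finrank_eq

/-- The rank drop estimate relative to a fixed subspace `W`. -/
theorem card_finrank_sup_span_drop_mul_le {F V ι κ : Type*} [Field F] [Fintype F] [AddCommGroup V]
    [Module F V] [Finite V] [Fintype ι] [Fintype κ] [DecidableEq ι] [DecidableEq κ]
    (hικ : Fintype.card ι ≤ Fintype.card κ) (W : Submodule F V) (x : ι → V) (y : κ → V) (a : ℕ) :
    Nat.card {M : ι → κ → F //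
      Module.finrank F
        (W ⊔ Submodule.span F (Set.range fun e => y e + ∑ d, M d e • x d) : Submodule F V) + a ≤
        Module.finrank F (W ⊔ Submodule.span F (Set.range x) : Submodule F V)} *
          (Fintype.card F - 1) ^ a ≤
      Fintype.card F ^ (Fintype.card ι * Fintype.card κ) := by
  have : Finite (V ⧸ W) := Finite.of_surjective W.mkQ W.mkQ_surjective
  have hM : ∀ M : ι → κ → F, (Submodule.span F (Set.range fun e => y e + ∑ d, M d e • x d)).map
      W.mkQ = Submodule.span F (Set.range fun e => W.mkQ (y e) + ∑ d, M d e • W.mkQ (x d)) := by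
    intro M
    rw [Submodule.map_span, ← Set.range_comp]
    congr 2
    ext1 e
    rw [Function.comp_apply, map_add, map_sum]
    simp only [map_smul]
  have hx : (Submodule.span F (Set.range x)).map W.mkQ =
      Submodule.span F (Set.range fun d => W.mkQ (x d)) := by
    rw [Submodule.map_span, ← Set.range_comp]
    rfl
  rw [Nat.card_congr (Equiv.subtypeEquivRight fun M => ?_)]
  · exact card_finrank_span_drop_mul_le hικ (fun d => W.mkQ (x d)) (fun e => W.mkQ (y e)) a
  · rw [Submodule.finrank_sup_eq_finrank_add_finrank_map_mkQ,
      Submodule.finrank_sup_eq_finrank_add_finrank_map_mkQ, hM, hx, add_assoc,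
      add_le_add_iff_left]

theorem card_fiber_mul_pow_finrank_range_le {F A B : Type*} [Field F] [Fintype F] [AddCommGroup A]
    [Module F A] [Fintype A] [AddCommGroup B] [Module F B] [DecidableEq B] (f : A →ₗ[F] B) (b : B) :
    (Finset.univ.filter fun a => f a = b).card *
      Fintype.card F ^ Module.finrank F (LinearMap.range f) ≤ Fintype.card A := by
  classical
  by_cases hb : ∃ a, f a = b
  · obtain ⟨a₀, rfl⟩ := hb
    have : Fintype (LinearMap.range f) := Fintype.ofFinite _
    rw [← Module.card_eq_pow_finrank (K := F) (V := LinearMap.range f),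
      ← card_fiber_mul_card_of_surjective f.rangeRestrict.toAddMonoidHom
        f.surjective_rangeRestrict ⟨f a₀, a₀, rfl⟩]
    refine le_of_eq ?_
    congr 2
    ext a
    simp [Subtype.ext_iff]
  · push Not at hb
    simp [hb]

/-- The rows of a uniformly random affine combination `y + M z` of vectors `z` of rank at least
`w + j` modulo `W` are dependent modulo `W` with probability at most `1 / (q - 1) ^ (j + 1)`. -/
theorem card_exists_combination_mem_mul_le {F V ι : Type*} [Field F] [Fintype F] [AddCommGroup V]
    [Module F V] [Finite V] [Fintype ι] [DecidableEq ι] (W : Submodule F V) (z : ι → V) (w j : ℕ)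
    (y : Fin w → V) (hj : Module.finrank F W + w + j ≤
      Module.finrank F (W ⊔ Submodule.span F (Set.range z) : Submodule F V)) :
    Nat.card {M : Fin w → ι → F //
      ∃ x : Fin w → F, x ≠ 0 ∧ ∑ i, x i • (y i + ∑ e, M i e • z e) ∈ W} *
        (Fintype.card F - 1) ^ (j + 1) ≤ Fintype.card (Fin w → ι → F) := by
  classical
  have : Finite (V ⧸ W) := Finite.of_surjective W.mkQ W.mkQ_surjective
  let f : (Fin w → F) → (Fin w → ι → F) →ₗ[F] V ⧸ W := fun x =>
    { toFun := fun M => W.mkQ (∑ i, x i • ∑ e, M i e • z e)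
      map_add' := fun M M' => by
        rw [← map_add]
        simp only [Pi.add_apply, add_smul, Finset.sum_add_distrib, smul_add]
      map_smul' := fun r M => by
        simp only [Pi.smul_apply, smul_eq_mul, mul_smul, ← Finset.smul_sum, RingHom.id_apply,
          ← map_smul]
        congr 1
        rw [Finset.smul_sum]
        exact Finset.sum_congr rfl fun i _ => smul_comm _ _ _ }
  have hrange : ∀ x : Fin w → F, x ≠ 0 → w + j ≤ Module.finrank F (LinearMap.range (f x)) := by
    intro x hx
    rw [Submodule.finrank_sup_eq_finrank_add_finrank_map_mkQ] at hj
    have h1 : (Submodule.span F (Set.range z)).map W.mkQ ≤ LinearMap.range (f x) := by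
      rw [Submodule.map_span, Submodule.span_le]
      rintro _ ⟨_, ⟨e, rfl⟩, rfl⟩
      obtain ⟨i, hi⟩ := Function.ne_iff.1 hx
      -- A nonzero coordinate `x i` suffices to reach every `z e`, so `f x` has rank at least `w +
      -- j` for each `x ≠ 0`.
      refine ⟨Pi.single i (Pi.single e (x i)⁻¹), ?_⟩
      change W.mkQ _ = _
      congr 1
      rw [Finset.sum_eq_single i, Finset.sum_eq_single e]
      · simp only [Pi.single_eq_same, smul_smul]
        rw [mul_inv_cancel₀ hi, one_smul]
      · intro e' _ he'; simp [he']
      · simp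
      · intro i' _ hi'; simp [hi']
      · simp
    have h2 := Submodule.finrank_mono h1
    omega
  set sol : (Fin w → ι → F) → (Fin w → F) → Prop := fun M x =>
    ∑ i, x i • (y i + ∑ e, M i e • z e) ∈ W with hsol
  have hsolf : ∀ M x, sol M x ↔ f x M = - W.mkQ (∑ i, x i • y i) := by
    intro M x
    change _ ∈ W ↔ _
    rw [← Submodule.Quotient.mk_eq_zero, eq_neg_iff_add_eq_zero]
    change W.mkQ _ = 0 ↔ W.mkQ _ + W.mkQ _ = 0
    rw [← map_add, ← Finset.sum_add_distrib]
    simp only [smul_add, add_comm]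
  set q := Fintype.card F with hq
  have hq1 : 1 < q := Fintype.one_lt_card
  set bad : Finset (Fin w → ι → F) := Finset.univ.filter fun M => ∃ x, x ≠ 0 ∧ sol M x
  set nz : Finset (Fin w → F) := Finset.univ.filter fun x => x ≠ 0
  -- Solutions come in punctured lines, so each bad matrix is counted at least `q - 1` times.
  -- Against `q ^ w` vectors `x`, each solved by a fraction at most `q ^ (-(w + j))`, this gives the
  -- exponent `j + 1` rather than `j`.
  have hlines : ∀ M ∈ bad, q - 1 ≤ (nz.filter fun x => sol M x).card := by
    intro M hM
    obtain ⟨x, hx, hMx⟩ := (Finset.mem_filter.1 hM).2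
    rw [← Fintype.card_units, ← Finset.card_univ]
    refine Finset.card_le_card_of_injOn (fun u : Fˣ => (u : F) • x) ?_ ?_
    · intro u _
      simp only [nz, Finset.coe_filter, Finset.mem_filter, Finset.mem_univ, true_and,
        Set.mem_ofPred_eq]
      refine ⟨smul_ne_zero u.ne_zero hx, ?_⟩
      have := W.smul_mem (u : F) hMx
      simpa [hsol, Finset.smul_sum, smul_smul, mul_assoc] using this
    · intro u _ u' _ h
      exact Units.ext (smul_left_injective F hx h)
  have hdouble : bad.card * (q - 1) ≤ ∑ x ∈ nz, (Finset.univ.filter fun M => sol M x).card := by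
    calc bad.card * (q - 1) ≤ ∑ M ∈ bad, (nz.filter fun x => sol M x).card := by
          rw [← smul_eq_mul, ← Finset.sum_const]
          exact Finset.sum_le_sum hlines
      _ ≤ ∑ M, (nz.filter fun x => sol M x).card :=
          Finset.sum_le_sum_of_subset (Finset.subset_univ _)
      _ = _ := by
          simp_rw [Finset.card_filter]
          exact Finset.sum_comm
  have hsolcard : ∀ x ∈ nz, (Finset.univ.filter fun M => sol M x).card * q ^ (w + j) ≤
      Fintype.card (Fin w → ι → F) := by
    intro x hx
    have h1 := card_fiber_mul_pow_finrank_range_le (f x) (- W.mkQ (∑ i, x i • y i))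
    simp only [← hsolf] at h1
    exact (Nat.mul_le_mul_left _
      (Nat.pow_le_pow_right hq1.le (hrange x (Finset.mem_filter.1 hx).2))).trans h1
  rw [Nat.card_eq_fintype_card, Fintype.card_subtype]
  change bad.card * _ ≤ _
  refine Nat.le_of_mul_le_mul_right ?_ (pow_pos (zero_lt_one.trans hq1) w)
  have hnz : nz.card ≤ q ^ w := (Finset.card_le_univ _).trans (by simp [q])
  calc bad.card * (q - 1) ^ (j + 1) * q ^ w
      = bad.card * (q - 1) * ((q - 1) ^ j * q ^ w) := by ring
    _ ≤ bad.card * (q - 1) * (q ^ j * q ^ w) := by gcongr; omega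
    _ ≤ (∑ x ∈ nz, (Finset.univ.filter fun M => sol M x).card) * (q ^ j * q ^ w) :=
        Nat.mul_le_mul_right _ hdouble
    _ = ∑ x ∈ nz, (Finset.univ.filter fun M => sol M x).card * q ^ (w + j) := by
        rw [Finset.sum_mul]
        exact Finset.sum_congr rfl fun x _ => by ring
    _ ≤ ∑ x ∈ nz, Fintype.card (Fin w → ι → F) := Finset.sum_le_sum hsolcard
    _ = nz.card * Fintype.card (Fin w → ι → F) := by simp
    _ ≤ q ^ w * Fintype.card (Fin w → ι → F) := Nat.mul_le_mul_right _ hnz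
    _ = _ := mul_comm _ _

/-! ### Cuts and transfer coefficients -/

namespace Network

variable {V E F : Type*} (N : Network V E) {w : ℕ}

theorem swap_precedes_wellFounded [Finite E] : WellFounded (Function.swap N.Precedes) := by
  have : Std.Irrefl (Function.swap (Relation.TransGen N.Precedes)) :=
    ⟨fun e h => N.acyclic _ (N.transGen_of_precedes h)⟩
  have h := Finite.wellFounded_of_trans_of_irrefl (Function.swap (Relation.TransGen N.Precedes))
  exact Subrelation.wf (fun h => Relation.TransGen.single (r := N.Precedes) h) h

/-- The cut consisting of the channels that leave a set of nodes. -/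
theorem minCut_le_card_leaving [DecidableEq V] [Fintype E] {t : V} (A : Finset V)
    (hs : N.source ∈ A) (ht : t ∉ A) :
    N.minCut t ≤ (Finset.univ.filter fun e => N.tail e ∈ A ∧ N.head e ∉ A).card := by
  refine Nat.sInf_le ⟨_, fun h => ht ?_, rfl⟩
  clear ht
  induction h with
  | refl => exact hs
  | tail _ h ih =>
    obtain ⟨e, he, rfl, rfl⟩ := h
    by_contra hcon
    exact he (Finset.mem_filter.2 ⟨Finset.mem_univ _, ih, hcon⟩)

theorem minCut_le_card_incoming [Fintype V] [DecidableEq V] [Fintype E] {t : V}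
    (ht : N.source ≠ t) : N.minCut t ≤ (Finset.univ.filter fun e => N.head e = t).card := by
  refine (N.minCut_le_card_leaving (Finset.univ.erase t) (by simp [ht]) (by simp)).trans
    (Finset.card_le_card fun e he => ?_)
  simp only [Finset.mem_filter, Finset.mem_univ, true_and, Finset.mem_erase, and_true,
    not_not] at he ⊢
  exact he.2

variable [DecidableEq V] [Field F]

/-- The local encoding coefficient `k_{c,e}`, extended by zero to pairs that are not adjacent. -/
def coeff (k : N.Code F w) (c : Fin w ⊕ E) (e : E) : F :=
  if h : N.chHead w c = N.tail e then k ⟨(c, e), h⟩ else 0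

variable {N}

theorem coeff_eq_zero (k : N.Code F w) {c : Fin w ⊕ E} {e : E} (h : N.chHead w c ≠ N.tail e) :
    N.coeff k c e = 0 := dif_neg h

theorem coeff_add (k k' : N.Code F w) (c : Fin w ⊕ E) (e : E) :
    N.coeff (k + k') c e = N.coeff k c e + N.coeff k' c e := by
  unfold coeff
  split_ifs <;> simp

variable [Fintype E] [DecidableEq E]

theorem kernel_apply (k : N.Code F w) (e : E) (c : Fin w ⊕ E) :
    N.kernel k e c = (∑ i : Fin w, N.coeff k (Sum.inl i) e * if c = Sum.inl i then 1 else 0) +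
      (∑ d : E, N.coeff k (Sum.inr d) e * N.kernel k d c) + if c = Sum.inr e then 1 else 0 := by
  have h := congrFun (N.kernel_eq k e) c
  rw [h, Pi.add_apply, Finset.sum_apply, Fintype.sum_sum_type]
  congr 1
  · congr 1
    · refine Finset.sum_congr rfl fun i _ => ?_
      unfold coeff
      split_ifs <;> simp_all [Pi.single_apply]
    · refine Finset.sum_congr rfl fun d _ => ?_
      unfold coeff
      split_ifs <;> simp
  · simp [Pi.single_apply]

theorem kernel_inr (k : N.Code F w) (x e : E) :
    N.kernel k x (Sum.inr e) = (∑ d : E, N.coeff k (Sum.inr d) x * N.kernel k d (Sum.inr e)) +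
      if e = x then 1 else 0 := by
  rw [kernel_apply]
  simp

theorem kernel_inl (k : N.Code F w) (x : E) (i : Fin w) :
    N.kernel k x (Sum.inl i) = N.coeff k (Sum.inl i) x +
      ∑ d : E, N.coeff k (Sum.inr d) x * N.kernel k d (Sum.inl i) := by
  rw [kernel_apply]
  simp

/-- Backward recursion: the transfer from `e` to `x` is the sum over the channels after `e`. -/
theorem kernel_inr_backward (k : N.Code F w) (x e : E) :
    N.kernel k x (Sum.inr e) = (if e = x then 1 else 0) +
      ∑ e' : E, N.coeff k (Sum.inr e) e' * N.kernel k x (Sum.inr e') := by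
  induction x using N.precedes_wellFounded.induction with
  | _ x ih =>
    have h1 : ∀ d : E, N.coeff k (Sum.inr d) x * N.kernel k d (Sum.inr e) =
        N.coeff k (Sum.inr d) x * (if e = d then 1 else 0) + ∑ e' : E,
          N.coeff k (Sum.inr e) e' * (N.coeff k (Sum.inr d) x * N.kernel k d (Sum.inr e')) := by
      intro d
      by_cases hd : N.Precedes d x
      · rw [ih d hd, mul_add, Finset.mul_sum]
        congr 1
        exact Finset.sum_congr rfl fun e' _ => mul_left_comm _ _ _
      · have : N.coeff k (Sum.inr d) x = 0 := coeff_eq_zero k hd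
        simp [this]
    rw [kernel_inr, Finset.sum_congr rfl fun d _ => h1 d, Finset.sum_add_distrib,
      Finset.sum_comm]
    simp only [← Finset.mul_sum]
    have h2 : ∀ e' : E, N.coeff k (Sum.inr e) e' * N.kernel k x (Sum.inr e') =
        N.coeff k (Sum.inr e) e' *
          ∑ d : E, N.coeff k (Sum.inr d) x * N.kernel k d (Sum.inr e') +
        N.coeff k (Sum.inr e) e' * if e' = x then 1 else 0 := fun e' => by
      rw [← mul_add, ← kernel_inr]
    rw [Finset.sum_congr rfl fun e' _ => h2 e', Finset.sum_add_distrib]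
    simp
    ring

/-- A message reaches `x` only by first being injected into source channels. Hence the message rows
at `t` are combinations of error rows, with the message coefficients as weights. -/
theorem kernel_inl_backward (k : N.Code F w) (x : E) (i : Fin w) :
    N.kernel k x (Sum.inl i) =
      ∑ e : E, N.coeff k (Sum.inl i) e * N.kernel k x (Sum.inr e) := by
  induction x using N.precedes_wellFounded.induction with
  | _ x ih =>
    have h1 : ∀ d : E, N.coeff k (Sum.inr d) x * N.kernel k d (Sum.inl i) = ∑ e : E,
          N.coeff k (Sum.inl i) e * (N.coeff k (Sum.inr d) x * N.kernel k d (Sum.inr e)) := by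
      intro d
      by_cases hd : N.Precedes d x
      · rw [ih d hd, Finset.mul_sum]
        exact Finset.sum_congr rfl fun e' _ => mul_left_comm _ _ _
      · have : N.coeff k (Sum.inr d) x = 0 := coeff_eq_zero k hd
        simp [this]
    rw [kernel_inl, Finset.sum_congr rfl fun d _ => h1 d, Finset.sum_comm]
    simp only [← Finset.mul_sum]
    have h2 : ∀ e : E, N.coeff k (Sum.inl i) e * N.kernel k x (Sum.inr e) =
        N.coeff k (Sum.inl i) e *
          ∑ d : E, N.coeff k (Sum.inr d) x * N.kernel k d (Sum.inr e) +
        N.coeff k (Sum.inl i) e * if e = x then 1 else 0 := fun e => by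
      rw [← mul_add, ← kernel_inr]
    rw [Finset.sum_congr rfl fun e _ => h2 e, Finset.sum_add_distrib]
    simp [add_comm]

/-- The kernels of channels starting in a set of nodes closed under predecessors depend only on the
coefficients at these nodes. -/
theorem kernel_congr_of_closed {k k' : N.Code F w} (U : Set V)
    (hU : ∀ e, N.head e ∈ U → N.tail e ∈ U)
    (h : ∀ c e, N.tail e ∈ U → N.coeff k c e = N.coeff k' c e) {x : E} (hx : N.tail x ∈ U) :
    N.kernel k x = N.kernel k' x := by
  induction x using N.precedes_wellFounded.induction with
  | _ x ih =>
    ext c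
    rw [kernel_apply, kernel_apply]
    congr 2
    · exact Finset.sum_congr rfl fun i _ => by rw [h _ _ hx]
    · refine Finset.sum_congr rfl fun d _ => ?_
      by_cases hd : N.Precedes d x
      · rw [h _ _ hx, ih d hd (hU d (by rw [show N.head d = N.tail x from hd]; exact hx))]
      · rw [coeff_eq_zero k (c := Sum.inr d) hd, coeff_eq_zero k' (c := Sum.inr d) hd]
        simp

/-- The transfer between real channels does not depend on the coefficients of the message
channels. -/
theorem kernel_inr_congr {k k' : N.Code F w}
    (h : ∀ d e, N.coeff k (Sum.inr d) e = N.coeff k' (Sum.inr d) e) (x e : E) :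
    N.kernel k x (Sum.inr e) = N.kernel k' x (Sum.inr e) := by
  induction x using N.precedes_wellFounded.induction with
  | _ x ih =>
    rw [kernel_inr, kernel_inr]
    congr 1
    refine Finset.sum_congr rfl fun d _ => ?_
    by_cases hd : N.Precedes d x
    · rw [h, ih d hd]
    · rw [coeff_eq_zero k (c := Sum.inr d) hd, coeff_eq_zero k' (c := Sum.inr d) hd]
      simp

/-- The row of the decoding matrix at `t` belonging to the channel `e`. -/
noncomputable def errorRow (k : N.Code F w) (t : V) (e : E) : {x : E // N.head x = t} → F :=
  fun x => N.kernel k x (Sum.inr e)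

theorem vecMul_decodingMatrix (k : N.Code F w) (t : V) (Y : Fin w ⊕ E → F) :
    (N.decodingMatrix k t).vecMulLinear Y =
      ∑ i, Y (Sum.inl i) • (∑ e, N.coeff k (Sum.inl i) e • errorRow k t e) +
        ∑ e, Y (Sum.inr e) • errorRow k t e := by
  ext x
  simp only [Matrix.vecMulLinear_apply, Matrix.vecMul, dotProduct, Fintype.sum_sum_type,
    decodingMatrix, Matrix.of_apply, Pi.add_apply, Finset.sum_apply, Pi.smul_apply, smul_eq_mul,
    errorRow, kernel_inl_backward]

theorem errorSpace_eq_span (k : N.Code F w) (t : V) (ρ : Finset E) :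
    N.errorSpace k t ρ = Submodule.span F (errorRow k t '' ρ) := by
  apply le_antisymm
  · rintro _ ⟨Y, ⟨h1, h2⟩, rfl⟩
    rw [vecMul_decodingMatrix]
    simp only [h1, zero_smul, Finset.sum_const_zero, zero_add]
    refine Submodule.sum_mem _ fun e _ => ?_
    by_cases he : e ∈ ρ
    · exact Submodule.smul_mem _ _ (Submodule.subset_span ⟨e, he, rfl⟩)
    · simp [h2 e he]
  · rw [Submodule.span_le]
    rintro _ ⟨e, he, rfl⟩
    refine ⟨Pi.single (Sum.inr e) 1, ⟨by simp, fun e' he' => ?_⟩, ?_⟩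
    · rw [Pi.single_apply, if_neg]
      rintro h
      cases h
      exact he' he
    · rw [vecMul_decodingMatrix]
      simp [Pi.single_apply]

theorem errorRow_mem_errorSpace (k : N.Code F w) (t : V) {ρ : Finset E} {e : E} (he : e ∈ ρ) :
    errorRow k t e ∈ N.errorSpace k t ρ := by
  rw [errorSpace_eq_span]
  exact Submodule.subset_span ⟨e, he, rfl⟩

theorem finrank_errorSpace_le (k : N.Code F w) (t : V) (ρ : Finset E) :
    Module.finrank F (N.errorSpace k t ρ) ≤ ρ.card := by
  classical
  rw [errorSpace_eq_span, ← Finset.coe_image]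
  exact (finrank_span_finset_le_card _).trans Finset.card_image_le

/-- An error on a channel that does not enter `t` acts at `t` only through the channels that follow
it. -/
theorem errorRow_eq_sum (k : N.Code F w) {t : V} {e : E} (he : N.head e ≠ t) :
    errorRow k t e = ∑ e', N.coeff k (Sum.inr e) e' • errorRow k t e' := by
  ext x
  simp only [errorRow, Finset.sum_apply, Pi.smul_apply, smul_eq_mul]
  rw [kernel_inr_backward, if_neg, zero_add]
  rintro rfl
  exact he x.2

end Network

/-! ### Domination and rank of error patterns as a cut problem -/

namespace Network

section Boundary

variable {V E : Type*} (N : Network V E)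

/-- The channels of `A` that enter `t` or are followed by a channel outside `A`. -/
def boundary [DecidableEq V] [Fintype E] [DecidableEq E] (t : V)
    (A : Finset E) : Finset E :=
  A.filter fun e => N.head e = t ∨ ∃ e', N.head e = N.tail e' ∧ e' ∉ A

/-- A follower outside `A ∪ B` is outside both sets, and one outside `A ∩ B` is outside at least one
of them. This is the uncrossing behind `exists_insert_full_rank`. -/
theorem boundary_submodular [DecidableEq V] [Fintype E] [DecidableEq E] (t : V)
    (A B : Finset E) :
    (N.boundary t (A ∪ B)).card + (N.boundary t (A ∩ B)).card ≤
      (N.boundary t A).card + (N.boundary t B).card := by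
  rw [← Finset.card_union_add_card_inter, ← Finset.card_union_add_card_inter (N.boundary t A)]
  refine add_le_add (Finset.card_le_card fun e he => ?_) (Finset.card_le_card fun e he => ?_)
  · simp only [boundary, Finset.mem_union, Finset.mem_inter, Finset.mem_filter] at he ⊢
    grind
  · simp only [boundary, Finset.mem_union, Finset.mem_inter, Finset.mem_filter] at he ⊢
    grind

/-- There is a path from the channel to `t` that avoids the pattern. -/
inductive Escapes (t : V) (ρ : Finset E) : E → Prop
  | last (e : E) : e ∉ ρ → N.head e = t → Escapes t ρ e
  | step (e e' : E) : e ∉ ρ → N.head e = N.tail e' → Escapes t ρ e' → Escapes t ρ e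

variable {N}

theorem Escapes.notMem {t : V} {ρ : Finset E} {e : E} (h : N.Escapes t ρ e) : e ∉ ρ := by
  cases h <;> assumption

theorem Escapes.exists_next {t : V} {ρ : Finset E} {e : E} (h : N.Escapes t ρ e)
    (he : N.head e ≠ t) : ∃ e', N.head e = N.tail e' ∧ N.Escapes t ρ e' := by
  cases h with
  | last _ _ h => exact absurd h he
  | step _ e' _ h h' => exact ⟨e', h, h'⟩

end Boundary

variable {V E F : Type*} [DecidableEq V] [Fintype E] [DecidableEq E] [Field F]
  {N : Network V E} {w : ℕ}

/-- Backward from `t`: the row of a channel in `A` but not in its boundary is a combination of rows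
of followers, all in `A`. So the boundary rows span all rows of `A`, for every code. -/
theorem dominated_of_boundary_subset {t : V} {ρ ρ' A : Finset E} (h₁ : ρ ⊆ A)
    (h₂ : N.boundary t A ⊆ ρ') : N.Dominated F w t ρ ρ' := by
  intro k
  have key : ∀ e ∈ A, errorRow k t e ∈ N.errorSpace k t ρ' := by
    intro e
    induction e using N.swap_precedes_wellFounded.induction with
    | _ e ih =>
      intro he
      by_cases hb : e ∈ N.boundary t A
      · exact errorRow_mem_errorSpace k t (h₂ hb)
      · simp only [boundary, Finset.mem_filter, not_and, not_or, not_exists, not_not] at hb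
        obtain ⟨h3, h4⟩ := hb he
        rw [errorRow_eq_sum k h3]
        refine Submodule.sum_mem _ fun e' _ => ?_
        by_cases hd : N.Precedes e e'
        · exact Submodule.smul_mem _ _ (ih e' hd (h4 e' hd))
        · rw [coeff_eq_zero k (c := Sum.inr e) hd, zero_smul]
          exact Submodule.zero_mem _
  rw [errorSpace_eq_span, Submodule.span_le]
  rintro _ ⟨e, he, rfl⟩
  exact key e (h₁ he)

/-- If a path from `e` to `t` avoids `ρ`, then for the code that forwards along such paths the
error at `e` is not matched by any error in `ρ`. -/
theorem Escapes.exists_code {t : V} {ρ : Finset E} {e : E} (h : N.Escapes t ρ e) (F : Type*)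
    [Field F] (w : ℕ) :
    ∃ k : N.Code F w, errorRow k t e ∉ N.errorSpace k t ρ := by
  classical
  have hnext : ∀ d, ∃ e', N.Escapes t ρ d → N.head d ≠ t →
      N.head d = N.tail e' ∧ N.Escapes t ρ e' := by
    intro d
    by_cases hd : N.Escapes t ρ d ∧ N.head d ≠ t
    · obtain ⟨e', he'⟩ := hd.1.exists_next hd.2
      exact ⟨e', fun _ _ => he'⟩
    · exact ⟨d, fun h1 h2 => absurd ⟨h1, h2⟩ hd⟩
  choose next hnext using hnext
  -- Each escaping channel forwards to a single escaping follower, and the channels of `ρ` forward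
  -- nothing. The error at `e` arrives on one final channel `x₀ ∉ ρ`, a coordinate on which the
  -- error space of `ρ` vanishes.
  let k : N.Code F w := fun p =>
    if ∃ d, p.1.1 = Sum.inr d ∧ N.Escapes t ρ d ∧ N.head d ≠ t ∧ next d = p.1.2 then 1 else 0
  have hk : ∀ d e', N.coeff k (Sum.inr d) e' =
      if N.Escapes t ρ d ∧ N.head d ≠ t ∧ next d = e' then 1 else 0 := by
    intro d e'
    unfold coeff
    split_ifs with h1 h2 h2
    · exact if_pos ⟨d, rfl, h2⟩
    · refine if_neg ?_
      rintro ⟨d', h3, h4⟩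
      cases h3
      exact h2 h4
    · obtain ⟨h3, h4, rfl⟩ := h2
      exact absurd (hnext d h3 h4).1 h1
    · rfl
  have hsingle : ∀ d, ¬ (N.Escapes t ρ d ∧ N.head d ≠ t) → ∀ x,
      N.kernel k x (Sum.inr d) = if d = x then 1 else 0 := by
    intro d hd x
    rw [kernel_inr_backward, Finset.sum_eq_zero, add_zero]
    intro e' _
    rw [hk, if_neg (fun h => hd ⟨h.1, h.2.1⟩), zero_mul]
  have hesc : ∀ d, N.Escapes t ρ d → ∃ x₀, N.Escapes t ρ x₀ ∧ N.head x₀ = t ∧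
      ∀ x : E, N.head x = t → N.kernel k x (Sum.inr d) = if x₀ = x then 1 else 0 := by
    intro d
    induction d using N.swap_precedes_wellFounded.induction with
    | _ d ih =>
      intro hd
      by_cases ht : N.head d = t
      · exact ⟨d, hd, ht, fun x _ => hsingle d (fun h => h.2 ht) x⟩
      · obtain ⟨h1, h2⟩ := hnext d hd ht
        obtain ⟨x₀, h3, h4, h5⟩ := ih (next d) h1 h2
        refine ⟨x₀, h3, h4, fun x hx => ?_⟩
        rw [← h5 x hx, kernel_inr_backward, if_neg (by rintro rfl; exact ht hx), zero_add,
          Finset.sum_eq_single (next d)]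
        · rw [hk, if_pos ⟨hd, ht, rfl⟩, one_mul]
        · intro e' _ he'
          rw [hk, if_neg (fun h => he' h.2.2.symm), zero_mul]
        · simp
  obtain ⟨x₀, h1, h2, h3⟩ := hesc e h
  refine ⟨k, fun hmem => ?_⟩
  have hle : N.errorSpace k t ρ ≤
      LinearMap.ker (LinearMap.proj (R := F) (φ := fun _ => F) (⟨x₀, h2⟩ : {x : E // N.head x = t})) := by
    rw [errorSpace_eq_span, Submodule.span_le]
    rintro _ ⟨d, hd, rfl⟩
    rw [SetLike.mem_coe, LinearMap.mem_ker, LinearMap.proj_apply]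
    have h4 := hsingle d (fun h => h.1.notMem hd) x₀
    rw [if_neg (by rintro rfl; exact h1.notMem hd)] at h4
    exact h4
  have h5 := hle hmem
  rw [LinearMap.mem_ker, LinearMap.proj_apply] at h5
  have h6 := h3 x₀ h2
  rw [if_pos rfl] at h6
  exact one_ne_zero (h6.symm.trans h5)

/-- Take for `A` the channels all of whose paths to `t` meet `ρ'`. With the converse
`dominated_of_boundary_subset`, domination becomes a property of the graph alone. -/
theorem Dominated.exists_boundary_subset {t : V} {ρ ρ' : Finset E} (h : N.Dominated F w t ρ ρ') :
    ∃ A : Finset E, ρ ⊆ A ∧ N.boundary t A ⊆ ρ' := by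
  classical
  refine ⟨Finset.univ.filter fun e => ¬ N.Escapes t ρ' e, fun e he => ?_, fun e he => ?_⟩
  · refine Finset.mem_filter.2 ⟨Finset.mem_univ _, fun hesc => ?_⟩
    obtain ⟨k, hk⟩ := hesc.exists_code F w
    exact hk (h k (errorRow_mem_errorSpace k t he))
  · simp only [boundary, Finset.mem_filter, Finset.mem_univ, true_and, not_not] at he
    by_contra hcon
    rcases he with ⟨h1, h2 | ⟨e', h2, h3⟩⟩
    · exact h1 (Escapes.last e hcon h2)
    · exact h1 (Escapes.step e e' hcon h2 h3)

theorem rank_le_of_dominated {t : V} {ρ ρ' : Finset E} (h : N.Dominated F w t ρ ρ') :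
    N.rank F w t ρ ≤ ρ'.card := Nat.sInf_le ⟨ρ', h, rfl⟩

theorem exists_dominated_card_eq_rank (N : Network V E) (F : Type*) [Field F] (w : ℕ) (t : V)
    (ρ : Finset E) : ∃ ρ', N.Dominated F w t ρ ρ' ∧ ρ'.card = N.rank F w t ρ :=
  Nat.sInf_mem (s := {n : ℕ | ∃ ρ' : Finset E, N.Dominated F w t ρ ρ' ∧ ρ'.card = n})
    ⟨_, ρ, fun _ => le_rfl, rfl⟩

theorem rank_le_card (t : V) (ρ : Finset E) : N.rank F w t ρ ≤ ρ.card :=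
  rank_le_of_dominated fun _ => le_rfl

theorem rank_le_card_boundary {t : V} {ρ A : Finset E} (h : ρ ⊆ A) :
    N.rank F w t ρ ≤ (N.boundary t A).card :=
  rank_le_of_dominated (dominated_of_boundary_subset h subset_rfl)

theorem exists_boundary_card_le_rank (N : Network V E) (F : Type*) [Field F] (w : ℕ) (t : V)
    (ρ : Finset E) : ∃ A, ρ ⊆ A ∧ (N.boundary t A).card ≤ N.rank F w t ρ := by
  obtain ⟨ρ', h1, h2⟩ := exists_dominated_card_eq_rank N F w t ρ
  obtain ⟨A, h3, h4⟩ := h1.exists_boundary_subset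
  exact ⟨A, h3, h2 ▸ Finset.card_le_card h4⟩

/-- A full rank pattern of size below the minimum cut capacity can be enlarged by one channel. -/
theorem exists_insert_full_rank [Fintype V] {t : V} (ht : N.source ≠ t) {ρ : Finset E}
    (hρ : N.rank F w t ρ = ρ.card) (hlt : ρ.card < N.minCut t) :
    ∃ e ∉ ρ, N.rank F w t (insert e ρ) = ρ.card + 1 := by
  by_contra! hcon
  have h1 : ∀ e, ∃ A : Finset E, insert e ρ ⊆ A ∧ (N.boundary t A).card ≤ ρ.card := by
    intro e
    obtain ⟨A, hA, hA'⟩ := exists_boundary_card_le_rank N F w t (insert e ρ)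
    refine ⟨A, hA, hA'.trans ?_⟩
    by_cases he : e ∈ ρ
    · rw [Finset.insert_eq_of_mem he, hρ]
    · have h2 := rank_le_card (N := N) (F := F) (w := w) t (insert e ρ)
      rw [Finset.card_insert_of_notMem he] at h2
      have := hcon e he
      omega
  -- If no channel raises the rank, the sets with boundary at most `|ρ|` are closed under union:
  -- their intersections contain `ρ`, so have boundary at least its rank `|ρ|`. The union of all of
  -- them is the full channel set, whose boundary contains the at least `minCut t` channels entering
  -- `t`.
  have h2 : ∀ S : Finset E, ∃ A : Finset E, S ∪ ρ ⊆ A ∧ (N.boundary t A).card ≤ ρ.card := by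
    intro S
    induction S using Finset.induction_on with
    | empty =>
      obtain ⟨A, hA, hA'⟩ := exists_boundary_card_le_rank N F w t ρ
      exact ⟨A, by simpa using hA, hρ ▸ hA'⟩
    | insert e S _ ih =>
      obtain ⟨A, hA, hA'⟩ := ih
      obtain ⟨B, hB, hB'⟩ := h1 e
      have h3 := N.boundary_submodular t A B
      have h4 : ρ ⊆ A ∩ B := Finset.subset_inter (Finset.union_subset_right hA)
        ((Finset.subset_insert e ρ).trans hB)
      have h5 := rank_le_card_boundary (N := N) (F := F) (w := w) (t := t) h4
      refine ⟨A ∪ B, ?_, by omega⟩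
      intro x hx
      simp only [Finset.mem_union, Finset.mem_insert] at hx ⊢
      rcases hx with (rfl | hx) | hx
      · exact Or.inr (hB (Finset.mem_insert_self _ _))
      · exact Or.inl (hA (Finset.mem_union_left _ hx))
      · exact Or.inl (hA (Finset.mem_union_right _ hx))
  obtain ⟨A, hA, hA'⟩ := h2 Finset.univ
  have hAu : A = Finset.univ := Finset.eq_univ_of_forall fun e => hA (by simp)
  have h3 := N.minCut_le_card_incoming ht
  have h4 : (Finset.univ.filter fun e => N.head e = t) ⊆ N.boundary t A := by
    intro e he
    subst hAu
    exact Finset.mem_filter.2 ⟨Finset.mem_univ _, Or.inl (Finset.mem_filter.1 he).2⟩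
  have h5 := Finset.card_le_card h4
  omega

theorem mem_fullRankPatterns {t : V} {β : ℕ} {ρ : Finset E} :
    ρ ∈ N.fullRankPatterns F w t β ↔ ρ.card = β ∧ N.rank F w t ρ = β := by
  simp [fullRankPatterns]

/-- Every error pattern of rank at most `β` is dominated by a full rank pattern of size `β`. -/
theorem exists_fullRankPattern_dominating [Fintype V] {t : V} (ht : N.source ≠ t) {ρ : Finset E}
    {β : ℕ} (hρ : N.rank F w t ρ ≤ β) (hβ : β ≤ N.minCut t) :
    ∃ ρ' ∈ N.fullRankPatterns F w t β, N.Dominated F w t ρ ρ' := by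
  induction β, hρ using Nat.le_induction with
  | base =>
    obtain ⟨ρ', h1, h2⟩ := exists_dominated_card_eq_rank N F w t ρ
    -- A smallest dominating pattern has full rank: a smaller one dominating it would also dominate
    -- `ρ`.
    refine ⟨ρ', mem_fullRankPatterns.2 ⟨h2, le_antisymm (h2 ▸ rank_le_card t ρ') ?_⟩, h1⟩
    obtain ⟨ρ'', h3, h4⟩ := exists_dominated_card_eq_rank N F w t ρ'
    rw [← h4]
    exact rank_le_of_dominated fun k => (h1 k).trans (h3 k)
  | succ β _ ih =>
    obtain ⟨ρ', h1, h2⟩ := ih (by omega)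
    obtain ⟨h3, h4⟩ := mem_fullRankPatterns.1 h1
    obtain ⟨e, he, h5⟩ := exists_insert_full_rank ht (h4.trans h3.symm) (by omega)
    refine ⟨insert e ρ', mem_fullRankPatterns.2 ⟨?_, by omega⟩, fun k => (h2 k).trans ?_⟩
    · rw [Finset.card_insert_of_notMem he, h3]
    · exact Submodule.map_mono fun Y hY =>
        ⟨hY.1, fun e' he' => hY.2 e' fun h => he' (Finset.mem_insert_of_mem h)⟩

end Network

theorem Fintype.sum_dite_eq_sum_subtype {ι A : Type*} [Fintype ι] [AddCommMonoid A] (p : ι → Prop)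
    [DecidablePred p] (f : {i // p i} → A) :
    ∑ i, (if h : p i then f ⟨i, h⟩ else 0) = ∑ i, f i := by
  have h := Finset.sum_subtype (Finset.univ.filter p) (p := p) (F := inferInstance) (by simp)
    (fun i => if h : p i then f ⟨i, h⟩ else 0)
  rw [Finset.sum_filter] at h
  calc _ = ∑ i, (if p i then if h : p i then f ⟨i, h⟩ else 0 else 0) :=
        Finset.sum_congr rfl fun i _ => by split_ifs <;> rfl
    _ = _ := h
    _ = _ := Finset.sum_congr rfl fun i _ => dif_pos i.2

/-! ### Rank loss while the processed node set grows -/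

namespace Network

section Crossing

variable {V E : Type*} [DecidableEq V] (N : Network V E)

/-- The channels of `P` that leave the node set `U`. -/
def crossing (P : Finset E) (U : Finset V) : Finset E :=
  P.filter fun e => N.tail e ∈ U ∧ N.head e ∉ U

/-- The channels of `P` that enter the node `v`. -/
abbrev InAt (P : Finset E) (v : V) : Type _ := {d : E // d ∈ P ∧ N.head d = v}

/-- The channels of `P` that leave the node `v`. -/
abbrev OutAt (P : Finset E) (v : V) : Type _ := {e : E // e ∈ P ∧ N.tail e = v}

variable {N}

/-- Together with `crossing_insert_eq_union`: adding `v` to `U` keeps a common set of channels and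
exchanges the channels of `P` into `v` for those out of `v`. -/
theorem crossing_eq_union (P : Finset E) {U : Finset V} {v : V} (hv : v ∉ U)
    (hvU : ∀ e, N.head e = v → N.tail e ∈ U) :
    (N.crossing P U : Set E) = {e | e ∈ P ∧ N.tail e ∈ U ∧ N.head e ∉ insert v U} ∪
      Set.range (Subtype.val : N.InAt P v → E) := by
  ext e
  simp only [crossing, Finset.coe_filter, Set.mem_ofPred_eq, Set.mem_union, Finset.mem_insert,
    Subtype.range_coe_subtype]
  by_cases h : N.head e = v
  · have := hvU e h
    simp [h, hv, this]
  · simp [h]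

theorem crossing_insert_eq_union (P : Finset E) {U : Finset V}
    (hU : ∀ e, N.head e ∈ U → N.tail e ∈ U) {v : V} (hv : v ∉ U) :
    (N.crossing P (insert v U) : Set E) =
      {e | e ∈ P ∧ N.tail e ∈ U ∧ N.head e ∉ insert v U} ∪
      Set.range (Subtype.val : N.OutAt P v → E) := by
  ext e
  simp only [crossing, Finset.coe_filter, Set.mem_ofPred_eq, Set.mem_union, Finset.mem_insert,
    Subtype.range_coe_subtype]
  by_cases h : N.tail e = v
  · have h1 : N.head e ∉ U := fun h' => hv (h ▸ hU e h')
    have h2 : N.head e ≠ v := fun h' => N.acyclic v (Relation.TransGen.single ⟨e, h, h'⟩)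
    simp [h, hv, h1, h2]
  · simp [h]

end Crossing

variable {V E F : Type*} [DecidableEq V] [DecidableEq E] [Field F]
  {N : Network V E} {w : ℕ}

/-- A change of the coefficients between the channels of `P` at the node `v`. -/
def nodeShift (w : ℕ) (P : Finset E) (v : V) (M : N.InAt P v → N.OutAt P v → F) : N.Code F w :=
  fun p => match p.1.1 with
    | Sum.inl _ => 0
    | Sum.inr d => if h : (d ∈ P ∧ N.head d = v) ∧ (p.1.2 ∈ P ∧ N.tail p.1.2 = v) then
        M ⟨d, h.1⟩ ⟨p.1.2, h.2⟩ else 0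

theorem coeff_nodeShift_inl (P : Finset E) (v : V) (M : N.InAt P v → N.OutAt P v → F)
    (i : Fin w) (e : E) : N.coeff (nodeShift w P v M) (Sum.inl i) e = 0 := by
  unfold coeff nodeShift
  split_ifs <;> rfl

theorem coeff_nodeShift_inr (P : Finset E) (v : V) (M : N.InAt P v → N.OutAt P v → F)
    (d e : E) : N.coeff (nodeShift w P v M) (Sum.inr d) e =
      if h : (d ∈ P ∧ N.head d = v) ∧ (e ∈ P ∧ N.tail e = v) then M ⟨d, h.1⟩ ⟨e, h.2⟩ else 0 := by
  unfold coeff nodeShift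
  split_ifs with h1 h2 h2
  · exact dif_pos h2
  · exact dif_neg h2
  · exact absurd (h2.1.2.trans h2.2.2.symm) h1
  · rfl

variable [Fintype E]

/-- The transfer from the source channels to the channel `x`. -/
noncomputable def sourceTransfer (k : N.Code F w) (x : E) : {e : E // N.tail e = N.source} → F :=
  fun e => N.kernel k x (Sum.inr e)

/-- The rank of the transfer from the source channels to the channels of `P` leaving `U`. -/
noncomputable def crossingRank (k : N.Code F w) (P : Finset E) (U : Finset V) : ℕ :=
  Module.finrank F (Submodule.span F (sourceTransfer k '' (N.crossing P U)))

theorem kernel_add_nodeShift_of_tail_mem (k : N.Code F w) (P : Finset E) {U : Finset V}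
    (hU : ∀ e, N.head e ∈ U → N.tail e ∈ U) {v : V} (hv : v ∉ U)
    (M : N.InAt P v → N.OutAt P v → F) {x : E} (hx : N.tail x ∈ U) :
    N.kernel (k + nodeShift w P v M) x = N.kernel k x := by
  refine kernel_congr_of_closed (U : Set V) hU (fun c e he => ?_) hx
  rw [coeff_add, add_eq_left]
  rcases c with i | d
  · exact coeff_nodeShift_inl P v M i e
  · rw [coeff_nodeShift_inr, dif_neg]
    rintro ⟨_, _, rfl⟩
    exact hv he

/-- The kernels entering `v` come from `U` and do not feel the shift, so the outgoing ones change
linearly in `M`. This is the form `y + x M` of the rank drop estimate. -/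
theorem kernel_add_nodeShift_of_outAt (k : N.Code F w) (P : Finset E) {U : Finset V}
    (hU : ∀ e, N.head e ∈ U → N.tail e ∈ U) {v : V} (hv : v ∉ U)
    (hvU : ∀ e, N.head e = v → N.tail e ∈ U) (M : N.InAt P v → N.OutAt P v → F)
    (x : N.OutAt P v) :
    N.kernel (k + nodeShift w P v M) x = N.kernel k x + ∑ d, M d x • N.kernel k d := by
  ext c
  have h1 : ∑ d : E, N.coeff (k + nodeShift w P v M) (Sum.inr d) x *
      N.kernel (k + nodeShift w P v M) d c =
      ∑ d : E, N.coeff k (Sum.inr d) x * N.kernel k d c + ∑ d, M d x * N.kernel k d c := by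
    have h2 : ∀ d : E, N.coeff (k + nodeShift w P v M) (Sum.inr d) x *
        N.kernel (k + nodeShift w P v M) d c = N.coeff k (Sum.inr d) x * N.kernel k d c +
        if h : d ∈ P ∧ N.head d = v then M ⟨d, h⟩ x * N.kernel k d c else 0 := by
      intro d
      by_cases hd : N.head d = N.tail x
      · rw [kernel_add_nodeShift_of_tail_mem k P hU hv M (hvU d (hd.trans x.2.2)), coeff_add,
          add_mul, coeff_nodeShift_inr]
        congr 1
        split_ifs with h3 h4 h4
        · rfl
        · exact absurd h3.1 h4
        · exact absurd ⟨h4, x.2⟩ h3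
        · exact zero_mul _
      · rw [coeff_eq_zero _ (c := Sum.inr d) hd, coeff_eq_zero _ (c := Sum.inr d) hd, dif_neg]
        · simp
        · exact fun h => hd (h.2.trans x.2.2.symm)
    rw [Finset.sum_congr rfl fun d _ => h2 d, Finset.sum_add_distrib]
    congr 1
    exact Fintype.sum_dite_eq_sum_subtype _ fun d => M d x * N.kernel k d c
  rw [kernel_apply, h1, Pi.add_apply, kernel_apply k]
  simp only [coeff_add, coeff_nodeShift_inl, add_zero, Finset.sum_apply, Pi.smul_apply, smul_eq_mul]
  ring

open Classical in
/-- Processing one more node loses rank `a - j` with probability at most `1 / (q - 1) ^ (a - j)`. -/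
theorem card_crossingRank_insert_loss_mul_le [Fintype F] (P : Finset E) {U : Finset V}
    (hU : ∀ e, N.head e ∈ U → N.tail e ∈ U) {v : V} (hv : v ∉ U)
    (hvU : ∀ e, N.head e = v → N.tail e ∈ U)
    (hflow : (P.filter fun e => N.head e = v).card ≤ (P.filter fun e => N.tail e = v).card)
    (C : ℕ) {j a : ℕ} (hja : j < a) :
    (Finset.univ.filter fun k : N.Code F w => C - crossingRank k P U = j ∧
      a ≤ C - crossingRank k P (insert v U)).card * (Fintype.card F - 1) ^ (a - j) ≤
    (Finset.univ.filter fun k : N.Code F w => C - crossingRank k P U = j).card := by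
  set B : Set E := {e | e ∈ P ∧ N.tail e ∈ U ∧ N.head e ∉ insert v U} with hB
  have hT : ∀ (k : N.Code F w) M x, N.tail x ∈ U →
      sourceTransfer (k + nodeShift w P v M) x = sourceTransfer k x := by
    intro k M x hx
    ext e
    simp only [sourceTransfer, kernel_add_nodeShift_of_tail_mem k P hU hv M hx]
  have hrank : ∀ k : N.Code F w, crossingRank k P U = Module.finrank F
      (Submodule.span F (sourceTransfer k '' B) ⊔ Submodule.span F
        (Set.range fun d : N.InAt P v => sourceTransfer k d) : Submodule F _) := by
    intro k
    rw [crossingRank, crossing_eq_union P hv hvU, Set.image_union, Submodule.span_union,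
      ← Set.range_comp]
    rfl
  have hrank' : ∀ (k : N.Code F w) M, crossingRank (k + nodeShift w P v M) P (insert v U) =
      Module.finrank F (Submodule.span F (sourceTransfer k '' B) ⊔ Submodule.span F
        (Set.range fun e : N.OutAt P v => sourceTransfer k e +
          ∑ d, M d e • sourceTransfer k (d : E)) : Submodule F _) := by
    intro k M
    rw [crossingRank, crossing_insert_eq_union P hU hv, Set.image_union, Submodule.span_union,
      ← Set.range_comp, Set.image_congr (fun e (he : e ∈ B) => hT k M e he.2.1)]
    have : sourceTransfer (k + nodeShift w P v M) ∘ (Subtype.val : N.OutAt P v → E) =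
        fun e : N.OutAt P v => sourceTransfer k e +
          ∑ d, M d e • sourceTransfer k (d : E) := by
      ext x e
      simp only [Function.comp_apply, sourceTransfer,
        kernel_add_nodeShift_of_outAt k P hU hv hvU M x, Pi.add_apply, Finset.sum_apply,
        Pi.smul_apply]
    rw [this]
  refine card_filter_and_mul_le_of_shift (nodeShift w P v) _ _ _ (fun k M => ?_) fun k hk => ?_
  · have : crossingRank (k + nodeShift w P v M) P U = crossingRank k P U := by
      rw [crossingRank, crossingRank, Set.image_congr fun e he =>
        hT k M e (Finset.mem_filter.1 he).2.1]
    rw [this]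
  · have hcard : Fintype.card (N.InAt P v) ≤ Fintype.card (N.OutAt P v) := by
      rw [Fintype.card_subtype, Fintype.card_subtype]
      convert hflow using 2 <;> ext <;> simp
    have h := card_finrank_sup_span_drop_mul_le hcard
      (Submodule.span F (sourceTransfer k '' B)) (fun d : N.InAt P v => sourceTransfer k d)
      (fun e : N.OutAt P v => sourceTransfer k e) (a - j)
    have hH : Fintype.card (N.InAt P v → N.OutAt P v → F) =
        Fintype.card F ^ (Fintype.card (N.InAt P v) * Fintype.card (N.OutAt P v)) := by
      simp [pow_mul, pow_right_comm]
    rw [hH]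
    refine le_trans (Nat.mul_le_mul_right _ ?_) h
    rw [Nat.card_eq_fintype_card, Fintype.card_subtype]
    refine Finset.card_le_card fun M hM => ?_
    simp only [Finset.mem_filter, Finset.mem_univ, true_and] at hM ⊢
    rw [← hrank', ← hrank]
    -- The truncated subtraction is harmless: if the old rank is at least `C` then `j = 0`, and a
    -- new rank at most `C - a` is still a drop of at least `a - j`.
    omega

/-- Nothing enters the source, so errors on its outgoing channels transfer to those channels as
distinct unit vectors; the process starts without loss. -/
theorem crossingRank_source (k : N.Code F w) (P : Finset E) :
    crossingRank k P {N.source} = (N.crossing P {N.source}).card := by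
  have hsingle : ∀ x : E, N.tail x = N.source → ∀ e,
      N.kernel k x (Sum.inr e) = if e = x then 1 else 0 := by
    intro x hx e
    rw [kernel_inr, Finset.sum_eq_zero, zero_add]
    intro d _
    rw [coeff_eq_zero, zero_mul]
    exact fun h => N.source_no_incoming d (h.trans hx)
  have hli : LinearIndependent F
      (fun x : N.crossing P {N.source} => sourceTransfer k (x : E)) := by
    have hmem : ∀ x : N.crossing P {N.source}, N.tail (x : E) = N.source := fun x =>
      Finset.mem_singleton.1 (Finset.mem_filter.1 x.2).2.1
    have heq : (fun x : N.crossing P {N.source} => sourceTransfer k (x : E)) =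
        (fun e : {e : E // N.tail e = N.source} => Pi.single e (1 : F)) ∘
          fun x : N.crossing P {N.source} => ⟨x, hmem x⟩ := by
      ext x e
      simp [sourceTransfer, hsingle _ (hmem x), Pi.single_apply, Subtype.ext_iff]
    rw [heq]
    refine (Pi.linearIndependent_single_one _ F).comp _ fun x y h => ?_
    exact Subtype.ext (congrArg (Subtype.val : {e : E // N.tail e = N.source} → E) h)
  have h := finrank_span_eq_card hli
  rw [crossingRank, ← Subtype.range_coe (s := (N.crossing P {N.source} : Set E)),
    ← Set.range_comp]
  rw [Fintype.card_coe] at h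
  exact h

open Classical in
/-- The rank loss along a flow has the tail bounds of a sum of geometric losses, one per processed
node. -/
theorem card_crossingRank_loss_mul_le [Fintype V] [Fintype F] (P : Finset E) (C : ℕ)
    (hC : C ≤ (N.crossing P {N.source}).card) (n : ℕ) :
    ∀ U : Finset V, N.source ∈ U → (∀ e, N.head e ∈ U → N.tail e ∈ U) →
      (∀ v ∈ U, v ≠ N.source →
        (P.filter fun e => N.head e = v).card ≤ (P.filter fun e => N.tail e = v).card) →
      U.card = n + 1 → ∀ a,
      (Finset.univ.filter fun k : N.Code F w => a ≤ C - crossingRank k P U).card *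
        (Fintype.card F - 1) ^ a ≤ Nat.multichoose n a * Fintype.card (N.Code F w) := by
  induction n with
  | zero =>
    intro U hs _ _ hcard a
    obtain ⟨v, hv⟩ := Finset.card_eq_one.1 hcard
    rw [hv, Finset.mem_singleton] at hs
    subst hv hs
    have h0 : ∀ k : N.Code F w, C - crossingRank k P {N.source} = 0 := fun k => by
      rw [crossingRank_source]; omega
    simp only [h0]
    cases a with
    | zero => simp
    | succ a => simp
  | succ n ih =>
    intro U hs hU hflow hcard a
    have hwf : WellFounded (Function.swap (Relation.TransGen
        (fun u u' : V => ∃ e : E, N.tail e = u ∧ N.head e = u'))) := by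
      have : Std.Irrefl (Function.swap (Relation.TransGen
        (fun u u' : V => ∃ e : E, N.tail e = u ∧ N.head e = u'))) := ⟨N.acyclic⟩
      exact Finite.wellFounded_of_trans_of_irrefl _
    -- `v` is a last node of `U` in topological order, so `U.erase v` is again closed under
    -- predecessors and contains all tails of channels into `v`.
    obtain ⟨v, hv, hmax⟩ := hwf.has_min {v | v ∈ U ∧ v ≠ N.source} (by
      obtain ⟨v, hv, hvs⟩ := Finset.exists_mem_ne (by omega : 1 < U.card) N.source
      exact ⟨v, hv, hvs⟩)
    have hnext : ∀ e, N.head e ∈ U → N.tail e ≠ v := fun e he h =>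
      hmax (N.head e) ⟨he, N.source_no_incoming e⟩ (Relation.TransGen.single ⟨e, h, rfl⟩)
    have hins : insert v (U.erase v) = U := Finset.insert_erase hv.1
    have hU' : ∀ e, N.head e ∈ U.erase v → N.tail e ∈ U.erase v := fun e he =>
      have he' := Finset.mem_of_mem_erase he
      Finset.mem_erase.2 ⟨hnext e he', hU e he'⟩
    have hvU : ∀ e, N.head e = v → N.tail e ∈ U.erase v := fun e he =>
      Finset.mem_erase.2 ⟨hnext e (he ▸ hv.1), hU e (he ▸ hv.1)⟩
    refine card_filter_mul_pow_le_multichoose (fun k => C - crossingRank k P (U.erase v)) _ n _ _ a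
      (ih (U.erase v) (Finset.mem_erase.2 ⟨hv.2.symm, hs⟩) hU'
        (fun u hu => hflow u (Finset.mem_of_mem_erase hu))
        (by rw [Finset.card_erase_of_mem hv.1, hcard]; rfl)) fun j hj => ?_
    have h := card_crossingRank_insert_loss_mul_le (F := F) (w := w) P hU' (Finset.notMem_erase v U)
      hvU (hflow v hv.1 hv.2) C hj
    rwa [hins] at h

end Network

/-! ### The message coefficients as the final stage -/

namespace Network

section Shift

variable {V E F : Type*} [DecidableEq V] [Field F] {N : Network V E} {w : ℕ}

/-- A change of the coefficients between the message channels and the source channels. -/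
def messageShift (M : Fin w → {e : E // N.tail e = N.source} → F) : N.Code F w :=
  fun p => match p.1.1 with
    | Sum.inl i => if h : N.tail p.1.2 = N.source then M i ⟨p.1.2, h⟩ else 0
    | Sum.inr _ => 0

theorem coeff_messageShift_inl (M : Fin w → {e : E // N.tail e = N.source} → F) (i : Fin w)
    (e : E) : N.coeff (messageShift M) (Sum.inl i) e =
      if h : N.tail e = N.source then M i ⟨e, h⟩ else 0 := by
  unfold coeff messageShift
  split_ifs with h1 h2 h2
  · rfl
  · exact absurd h1.symm h2
  · exact absurd h2.symm h1
  · rfl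

theorem coeff_messageShift_inr (M : Fin w → {e : E // N.tail e = N.source} → F) (d e : E) :
    N.coeff (messageShift M) (Sum.inr d) e = 0 := by
  unfold coeff messageShift
  split_ifs <;> rfl

end Shift

variable {V E F : Type*} [DecidableEq V] [Fintype E] [DecidableEq E] [Field F]
  {N : Network V E} {w : ℕ}

/-- The rank of the transfer from the source channels to the incoming channels of `t`. -/
noncomputable def sourceRank (k : N.Code F w) (t : V) : ℕ :=
  Module.finrank F
    (Submodule.span F (Set.range fun e : {e : E // N.tail e = N.source} => errorRow k t e))

/-- Row rank equals column rank: the node process tracks columns, one per channel, while the final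
stage combines rows, one per source channel. -/
theorem crossingRank_le_sourceRank (k : N.Code F w) {t : V} {P : Finset E} {U : Finset V}
    (h : ∀ e ∈ N.crossing P U, N.head e = t) : crossingRank k P U ≤ sourceRank k t := by
  let A : Matrix {e : E // N.tail e = N.source} {x : E // N.head x = t} F :=
    Matrix.of fun e x => N.kernel k x (Sum.inr (e : E))
  have h1 : sourceRank k t = A.rank := A.rank_eq_finrank_span_row.symm
  rw [h1, A.rank_eq_finrank_span_cols]
  refine Submodule.finrank_mono (Submodule.span_mono ?_)
  rintro _ ⟨x, hx, rfl⟩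
  exact ⟨⟨x, h x hx⟩, rfl⟩

open Classical in
/-- The tail bounds for the rank loss of the internal nodes. -/
theorem card_sourceRank_loss_mul_le [Fintype V] [Fintype F] (N : Network V E) {t : V}
    (ht : t ∈ N.sinks) (a : ℕ) :
    (Finset.univ.filter fun k : N.Code F w => a ≤ N.minCut t - sourceRank k t).card *
      (Fintype.card F - 1) ^ a ≤
        Nat.multichoose N.internalNodes.card a * Fintype.card (N.Code F w) := by
  have hst : N.source ≠ t := fun h => N.source_notMem_sinks (h ▸ ht)
  obtain ⟨P, hP, hflow⟩ := exists_flow_of_le_cut N.tail N.head N.source t (N.minCut t)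
    fun A => N.minCut_le_card_leaving A
  set U : Finset V := Finset.univ \ N.sinks with hUdef
  have hUmem : ∀ v, v ∈ U ↔ v ∉ N.sinks := fun v => by simp [hUdef]
  have hs : N.source ∈ U := (hUmem _).2 N.source_notMem_sinks
  -- Another sink emits no channels, so by the flow inequality it receives none from `P`. Hence `P`
  -- leaves the set of non-sinks only into `t`.
  have hhead : ∀ e ∈ N.crossing P U, N.head e = t := by
    intro e he
    obtain ⟨heP, _, he⟩ := Finset.mem_filter.1 he
    rw [hUmem, not_not] at he
    by_contra hne
    have h1 := hflow (N.head e) (N.source_no_incoming e) hne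
    have h2 : (P.filter fun e' => N.tail e' = N.head e) = ∅ :=
      Finset.filter_eq_empty_iff.2 fun e' _ h => N.sink_no_outgoing e' (h ▸ he)
    rw [h2, Finset.card_empty, Nat.le_zero, Finset.card_eq_zero] at h1
    exact Finset.notMem_empty e (h1 ▸ Finset.mem_filter.2 ⟨heP, rfl⟩)
  have hJ : N.internalNodes = U.erase N.source := by
    ext v
    simp [internalNodes, hUdef]
  have hcard : U.card = N.internalNodes.card + 1 := by
    rw [hJ, Finset.card_erase_add_one hs]
  have h := card_crossingRank_loss_mul_le (F := F) (w := w) P (N.minCut t)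
    (hP {N.source} (by simp) (by simpa using hst.symm)) N.internalNodes.card U hs
    (fun e _ => (hUmem _).2 (N.sink_no_outgoing e))
    (fun v hv hvs => hflow v hvs (by rintro rfl; exact (hUmem v).1 hv ht)) hcard a
  refine le_trans (Nat.mul_le_mul_right _ (Finset.card_le_card fun k hk => ?_)) h
  simp only [Finset.mem_filter, Finset.mem_univ, true_and] at hk ⊢
  have := crossingRank_le_sourceRank k hhead
  omega

/-- The vector received at `t` when `x` is sent and no errors occur. -/
noncomputable def received (k : N.Code F w) (t : V) : (Fin w → F) →ₗ[F]
    ({x : E // N.head x = t} → F) :=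
  Fintype.linearCombination F fun i => ∑ e, N.coeff k (Sum.inl i) e • errorRow k t e

theorem messageSpace_eq_range (k : N.Code F w) (t : V) :
    N.messageSpace k t = LinearMap.range (received k t) := by
  ext y
  constructor
  · rintro ⟨Y, hY, rfl⟩
    refine ⟨fun i => Y (Sum.inl i), ?_⟩
    rw [vecMul_decodingMatrix, received, Fintype.linearCombination_apply,
      Finset.sum_eq_zero (s := Finset.univ) (f := fun e => Y (Sum.inr e) • errorRow k t e)
      (fun e _ => by rw [hY e, zero_smul]), add_zero]
  · rintro ⟨x, rfl⟩
    refine ⟨Sum.elim x 0, fun e => rfl, ?_⟩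
    rw [vecMul_decodingMatrix, received, Fintype.linearCombination_apply]
    simp

/-- Some nonzero message can be confused with an error matching the pattern `ρ`. -/
def Confusable (k : N.Code F w) (t : V) (ρ : Finset E) : Prop :=
  ∃ x : Fin w → F, x ≠ 0 ∧ received k t x ∈ N.errorSpace k t ρ

theorem finrank_messageSpace_le (k : N.Code F w) (t : V) :
    Module.finrank F (N.messageSpace k t) ≤ w := by
  rw [messageSpace_eq_range]
  simpa using LinearMap.finrank_range_le (received k t)

/-- Some nonzero message is received as `0`, which lies in every error space; non-decodability thus
needs no separate estimate. -/
theorem confusable_of_finrank_lt {k : N.Code F w} {t : V} (ρ : Finset E)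
    (h : Module.finrank F (N.messageSpace k t) < w) : Confusable k t ρ := by
  have h1 := LinearMap.finrank_range_add_finrank_ker (received k t)
  rw [← messageSpace_eq_range, Module.finrank_fin_fun] at h1
  have h2 : LinearMap.ker (received k t) ≠ ⊥ := fun h3 => by
    rw [h3, finrank_bot] at h1
    omega
  obtain ⟨x, hx, hx0⟩ := Submodule.exists_mem_ne_zero_of_ne_bot h2
  exact ⟨x, hx0, by rw [LinearMap.mem_ker.1 hx]; exact Submodule.zero_mem _⟩

theorem confusable_of_finrank_inf_pos {k : N.Code F w} {t : V} {ρ : Finset E}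
    (h : 0 < Module.finrank F (N.errorSpace k t ρ ⊓ N.messageSpace k t :
      Submodule F ({e : E // N.head e = t} → F))) : Confusable k t ρ := by
  have hne : (N.errorSpace k t ρ ⊓ N.messageSpace k t :
      Submodule F ({e : E // N.head e = t} → F)) ≠ ⊥ := fun h0 => by
    rw [h0, finrank_bot] at h
    exact lt_irrefl _ h
  obtain ⟨y, hy, hy0⟩ := Submodule.exists_mem_ne_zero_of_ne_bot hne
  obtain ⟨h1, h2⟩ := Submodule.mem_inf.1 hy
  rw [messageSpace_eq_range] at h2
  obtain ⟨x, rfl⟩ := h2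
  exact ⟨x, by rintro rfl; exact hy0 (map_zero _), h1⟩

theorem exists_confusable_of_failure [Fintype V] {k : N.Code F w} {t : V} (ht : t ∈ N.sinks)
    {β : ℕ} (hβ : β ≤ N.minCut t)
    (h : Module.finrank F (N.messageSpace k t) < w ∨ N.minDist k t < (β : ℕ∞) + 1) :
    ∃ ρ ∈ N.fullRankPatterns F w t β, Confusable k t ρ := by
  have hst : N.source ≠ t := fun h => N.source_notMem_sinks (h ▸ ht)
  rcases h with h | h
  · obtain ⟨ρ, hρ, _⟩ := exists_fullRankPattern_dominating (F := F) (w := w) hst (ρ := ∅)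
      ((rank_le_card t ∅).trans (Nat.zero_le β)) hβ
    exact ⟨ρ, hρ, confusable_of_finrank_lt ρ h⟩
  · simp only [minDist, iInf_lt_iff] at h
    obtain ⟨ρ, hpos, hlt⟩ := h
    have hrank : N.rank F w t ρ ≤ β := by
      have : N.rank F w t ρ < β + 1 := by exact_mod_cast hlt
      omega
    obtain ⟨ρ', hρ', hdom⟩ := exists_fullRankPattern_dominating hst hrank hβ
    obtain ⟨x, hx0, hx⟩ := confusable_of_finrank_inf_pos hpos
    exact ⟨ρ', hρ', x, hx0, hdom k hx⟩

/-- Transfers between real channels ignore the message coefficients. Shifting these therefore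
preserves error spaces and `sourceRank`, while the received vector moves as an affine function. -/
theorem errorRow_add_messageShift (k : N.Code F w) (t : V)
    (M : Fin w → {e : E // N.tail e = N.source} → F) (e : E) :
    errorRow (k + messageShift M) t e = errorRow k t e := by
  ext x
  exact kernel_inr_congr (fun d e => by rw [coeff_add, coeff_messageShift_inr, add_zero]) (x : E) e

theorem errorSpace_add_messageShift (k : N.Code F w) (t : V)
    (M : Fin w → {e : E // N.tail e = N.source} → F) (ρ : Finset E) :
    N.errorSpace (k + messageShift M) t ρ = N.errorSpace k t ρ := by
  rw [errorSpace_eq_span, errorSpace_eq_span]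
  congr 1
  exact Set.image_congr fun e _ => errorRow_add_messageShift k t M e

theorem sourceRank_add_messageShift (k : N.Code F w) (t : V)
    (M : Fin w → {e : E // N.tail e = N.source} → F) :
    sourceRank (k + messageShift M) t = sourceRank k t := by
  have h : (fun e : {e : E // N.tail e = N.source} => errorRow (k + messageShift M) t e) =
      fun e : {e : E // N.tail e = N.source} => errorRow k t e :=
    funext fun e => errorRow_add_messageShift k t M e
  rw [sourceRank, sourceRank, h]

theorem received_add_messageShift (k : N.Code F w) (t : V)
    (M : Fin w → {e : E // N.tail e = N.source} → F) (x : Fin w → F) :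
    received (k + messageShift M) t x = ∑ i, x i •
      (∑ e, N.coeff k (Sum.inl i) e • errorRow k t e + ∑ e, M i e • errorRow k t (e : E)) := by
  rw [received, Fintype.linearCombination_apply]
  refine Finset.sum_congr rfl fun i _ => ?_
  congr 1
  simp only [coeff_add, errorRow_add_messageShift, add_smul, Finset.sum_add_distrib]
  congr 1
  rw [← Fintype.sum_dite_eq_sum_subtype (fun e => N.tail e = N.source)
    fun e => M i e • errorRow k t (e : E)]
  refine Finset.sum_congr rfl fun e _ => ?_
  rw [coeff_messageShift_inl]
  split_ifs
  · rfl
  · exact zero_smul _ _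

open Classical in
/-- The tail bound for a fixed error pattern. -/
theorem card_confusable_mul_le [Fintype V] [Fintype F] (N : Network V E) {t : V}
    (ht : t ∈ N.sinks) {ρ : Finset E} (a : ℕ) (ha : ρ.card + w + a ≤ N.minCut t + 1) :
    (Finset.univ.filter fun k : N.Code F w => Confusable k t ρ).card *
      (Fintype.card F - 1) ^ a ≤
        Nat.multichoose (N.internalNodes.card + 1) a * Fintype.card (N.Code F w) := by
  refine card_filter_mul_pow_le_multichoose (fun k => N.minCut t - sourceRank k t) _ _ _ _ a
    (card_sourceRank_loss_mul_le N ht) fun j hj => ?_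
  refine card_filter_and_mul_le_of_shift messageShift _ _ _ (fun k M => ?_) fun k hk => ?_
  · rw [sourceRank_add_messageShift]
  · obtain ⟨b, rfl⟩ : ∃ b, a = j + (b + 1) := ⟨a - j - 1, by omega⟩
    have h1 : Module.finrank F (N.errorSpace k t ρ) + w + b ≤ Module.finrank F
        (N.errorSpace k t ρ ⊔ Submodule.span F
          (Set.range fun e : {e : E // N.tail e = N.source} => errorRow k t e) :
            Submodule F ({x : E // N.head x = t} → F)) := by
      have h2 := finrank_errorSpace_le k t ρ
      have h3 : sourceRank k t ≤ _ := Submodule.finrank_mono (le_sup_right (a := N.errorSpace k t ρ))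
      omega
    have h4 := card_exists_combination_mem_mul_le (N.errorSpace k t ρ) _ w b
      (fun i => ∑ e, N.coeff k (Sum.inl i) e • errorRow k t e) h1
    rw [Nat.card_eq_fintype_card, Fintype.card_subtype] at h4
    rw [Nat.add_sub_cancel_left]
    convert h4 using 5 with M
    simp only [Confusable, received_add_messageShift, errorSpace_add_messageShift]

end Network

/-! ### From proportions of codes to probabilities -/

namespace Network

section RandomCode

variable {V E F Ω : Type*} [DecidableEq V] [Fintype E] [DecidableEq E] [Fintype F]
  [MeasurableSpace F] [MeasurableSingletonClass F] [MeasurableSpace Ω] {P : Measure Ω}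
  [IsProbabilityMeasure P] {N : Network V E} {w : ℕ} {k : N.AdjPair w → Ω → F}

theorem IsRandomCode.measureReal_singleton (hk : N.IsRandomCode P k) (κ : N.Code F w) :
    (P.map fun ω p => k p ω).real {κ} = (Fintype.card (N.Code F w) : ℝ)⁻¹ := by
  rw [(iIndepFun_iff_map_fun_eq_pi_map fun p => (hk.measurable p).aemeasurable).1 hk.indep]
  have : ∀ p, IsProbabilityMeasure (P.map (k p)) := fun p =>
    Measure.isProbabilityMeasure_map (hk.measurable p).aemeasurable
  rw [Measure.real, Measure.pi_singleton]
  simp [hk.uniform, uniformOn_univ]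

open Classical in
/-- Probabilities of events about a random code are proportions of codes. -/
theorem IsRandomCode.measureReal_setOf (hk : N.IsRandomCode P k) (Q : N.Code F w → Prop) :
    P.real {ω | Q fun p => k p ω} =
      ((Finset.univ.filter Q).card : ℝ) / Fintype.card (N.Code F w) := by
  have hmeas : Measurable fun ω p => k p ω := measurable_pi_iff.2 hk.measurable
  have : IsProbabilityMeasure (P.map fun ω p => k p ω) :=
    Measure.isProbabilityMeasure_map hmeas.aemeasurable
  have h := map_measureReal_apply (μ := P) hmeas (s := (Finset.univ.filter Q : Finset (N.Code F w)))
    (Finset.measurableSet _)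
  rw [← sum_measureReal_singleton] at h
  simp only [hk.measureReal_singleton, Finset.sum_const, nsmul_eq_mul] at h
  rw [div_eq_mul_inv, h]
  congr 1
  ext ω
  simp

variable [Field F]

theorem IsRandomCode.measureReal_confusable_le [Fintype V] (hk : N.IsRandomCode P k) {t : V}
    (ht : t ∈ N.sinks) {ρ : Finset E} (a : ℕ) (ha : ρ.card + w + a ≤ N.minCut t + 1) :
    P.real {ω | Confusable (N := N) (fun p => k p ω) t ρ} ≤
      (Nat.choose (N.internalNodes.card + a) N.internalNodes.card : ℝ) /
        ((Fintype.card F : ℝ) - 1) ^ a := by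
  classical
  have hq : 1 < Fintype.card F := Fintype.one_lt_card
  have hq' : (0 : ℝ) < (Fintype.card F : ℝ) - 1 := by
    rw [sub_pos]; exact_mod_cast hq
  have h := card_confusable_mul_le (F := F) (w := w) N ht a ha
  -- `multichoose (|J| + 1) a` is `choose (|J| + a) a`, hence `choose (|J| + a) |J|`.
  rw [Nat.multichoose_eq, Nat.add_right_comm, Nat.add_sub_cancel,
    ← Nat.choose_symm_add] at h
  rw [hk.measureReal_setOf fun κ => Confusable κ t ρ, div_le_div_iff₀ (by positivity) (by positivity)]
  have h' : (((Finset.univ.filter fun k : N.Code F w => Confusable k t ρ).card *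
      (Fintype.card F - 1) ^ a : ℕ) : ℝ) ≤ _ := Nat.cast_le.2 h
  push_cast [Nat.cast_sub hq.le] at h'
  convert h' using 3

theorem IsRandomCode.failureProbAt_le [Fintype V] (hk : N.IsRandomCode P k) {t : V}
    (ht : t ∈ N.sinks) (hw : w ≤ N.minCut t) {β : ℕ} (hβ : β ≤ N.redundancy w t) :
    N.failureProbAt P k t β ≤ N.failureBound F w t β := by
  unfold redundancy at hβ
  have hsub : {ω | Module.finrank F (N.messageSpace (fun p => k p ω) t) < w ∨
      N.minDist (fun p => k p ω) t < (β : ℕ∞) + 1} ⊆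
      ⋃ ρ ∈ N.fullRankPatterns F w t β, {ω | Confusable (N := N) (fun p => k p ω) t ρ} := by
    intro ω hω
    obtain ⟨ρ, hρ, h⟩ := exists_confusable_of_failure ht (by omega) hω
    exact Set.mem_biUnion hρ h
  calc N.failureProbAt P k t β
      ≤ P.real (⋃ ρ ∈ N.fullRankPatterns F w t β,
          {ω | Confusable (N := N) (fun p => k p ω) t ρ}) := measureReal_mono hsub (measure_ne_top _ _)
    _ ≤ ∑ ρ ∈ N.fullRankPatterns F w t β,
          P.real {ω | Confusable (N := N) (fun p => k p ω) t ρ} := measureReal_biUnion_finset_le _ _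
    _ ≤ ∑ ρ ∈ N.fullRankPatterns F w t β,
          (Nat.choose (N.internalNodes.card + (N.redundancy w t - β + 1))
            N.internalNodes.card : ℝ) /
              ((Fintype.card F : ℝ) - 1) ^ (N.redundancy w t - β + 1) :=
        -- With `a = δ - β + 1` and `|ρ| = β`, the condition `|ρ| + w + a ≤ minCut t + 1` holds with
        -- equality.
        Finset.sum_le_sum fun ρ hρ => hk.measureReal_confusable_le ht _ (by
          rw [(mem_fullRankPatterns.1 hρ).1]
          unfold redundancy
          omega)
    _ = N.failureBound F w t β := by
        rw [Finset.sum_const, nsmul_eq_mul, failureBound, mul_div_assoc,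
          add_comm N.internalNodes.card, add_right_comm _ 1]

end RandomCode

theorem failureProb_le_sum {V E F Ω : Type*} [DecidableEq V] [Fintype E] [DecidableEq E] [Field F]
    [MeasurableSpace Ω] {N : Network V E} {w : ℕ} (P : Measure Ω) [IsProbabilityMeasure P]
    (k : N.AdjPair w → Ω → F) (β : V → ℕ) :
    N.failureProb P k β ≤ ∑ t ∈ N.sinks, N.failureProbAt P k t (β t) := by
  refine le_trans (measureReal_mono ?_ (measure_ne_top _ _)) (measureReal_biUnion_finset_le _ _)
  rintro ω (h | ⟨t, ht, h⟩)
  · simp only [IsRegular, not_forall] at h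
    obtain ⟨t, ht, h⟩ := h
    exact Set.mem_biUnion ht (Or.inl (lt_of_le_of_ne (finrank_messageSpace_le _ t) h))
  · exact Set.mem_biUnion ht (Or.inr h)

end Network

theorem mainTheorem5 {V E F Ω : Type*} [Fintype V] [DecidableEq V] [Fintype E] [DecidableEq E]
    [Field F] [Fintype F] [MeasurableSpace F] [MeasurableSingletonClass F]
    [MeasurableSpace Ω] (P : Measure Ω) [IsProbabilityMeasure P]
    (N : Network V E) (w : ℕ) (hw : ∀ t ∈ N.sinks, w ≤ N.minCut t)
    (k : N.AdjPair w → Ω → F) (hk : N.IsRandomCode P k) :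
    (∀ t ∈ N.sinks, ∀ β : ℕ, β ≤ N.redundancy w t →
      N.failureProbAt P k t β ≤ N.failureBound F w t β) ∧
    (∀ β : V → ℕ, (∀ t ∈ N.sinks, β t ≤ N.redundancy w t) →
      N.failureProb P k β ≤ ∑ t ∈ N.sinks, N.failureBound F w t (β t)) :=
  ⟨fun _ ht _ hβ => hk.failureProbAt_le ht (hw _ ht) hβ,
    fun β hβ => (Network.failureProb_le_sum P k β).trans
      (Finset.sum_le_sum fun t ht => hk.failureProbAt_le ht (hw t ht) (hβ t ht))⟩
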